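/- Let $S \subset \mathbb{P}^3(\mathbb{C})$ be a quartic surface, given by a nonzero homogeneous polynomial of degree $4$, that contains only finitely many lines, and suppose that $S$ contains a line $\ell_0$ of double points, i.e. a line every point of which is a singular point of $S$. For a plane $H \supset \ell_0$ let $C_H \in |\mathcal{O}_S(1) - 2\ell_0|$ denote the conic residual to $2\ell_0$ in the plane section $S \cap H$, i.e. the conic $\{q = 0\} \subset H$, where the equation of $S$ restricted to $H$ is $m^2 q$ with $m$ a linear form defining $\ell_0$ in $H$ and $q$ a nonzero quadratic form on $H$. Then a general such conic meets at most $19$ lines on $S$: for all but finitely many planes $H$ containing $\ell_0$, the residual conic $C_H$ exists and at most $19$ lines contained in $S$ (the line $\ell_0$ being counted as one of them) have a point in common with $C_H$. -/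

import Mathlib

/-- A line in `ℙ³(ℂ)`, given as a two-dimensional linear subspace of `ℂ⁴`. -/
def IsProjLine (L : Submodule ℂ (Fin 4 → ℂ)) : Prop :=
  Module.finrank ℂ L = 2

/-- A plane in `ℙ³(ℂ)`, given as a three-dimensional linear subspace of `ℂ⁴`. -/
def IsProjPlane (H : Submodule ℂ (Fin 4 → ℂ)) : Prop :=
  Module.finrank ℂ H = 3

/-- `F` is an equation of a quartic surface in `ℙ³(ℂ)`. -/
def IsQuarticForm (F : MvPolynomial (Fin 4) ℂ) : Prop :=
  F.IsHomogeneous 4 ∧ F ≠ 0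

/-- The lines contained in the surface `F = 0`. -/
def linesOn (F : MvPolynomial (Fin 4) ℂ) : Set (Submodule ℂ (Fin 4 → ℂ)) :=
  {L | IsProjLine L ∧ ∀ v ∈ L, MvPolynomial.eval v F = 0}

/-- `ℓ` is a line of double points of the surface `F = 0`: every point of `ℓ` is a singular point
of the surface. (If `ℓ` were a line of triple points, the surface would contain infinitely many
lines; single points of higher multiplicity on `ℓ` are allowed.) -/
def IsLineOfDoublePoints (F : MvPolynomial (Fin 4) ℂ) (ℓ : Submodule ℂ (Fin 4 → ℂ)) : Prop :=
  IsProjLine ℓ ∧ ∀ v ∈ ℓ, MvPolynomial.eval v F = 0 ∧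
    ∀ i, MvPolynomial.eval v (MvPolynomial.pderiv i F) = 0

/-- The pencil of planes through `ℓ`. It parametrizes the residual conics. -/
def planesThrough (ℓ : Submodule ℂ (Fin 4 → ℂ)) : Set (Submodule ℂ (Fin 4 → ℂ)) :=
  {H | IsProjPlane H ∧ ℓ ≤ H}

/-- The quadratic form `q`, restricted to the plane `H`, is an equation of the conic residual to
`2ℓ` in the section of the surface `F = 0` by `H`: one has `F|_H = m² · q|_H` with `m` a linear
form whose zero locus in `H` is the line `ℓ`, and `q|_H ≠ 0`. The form `q|_H` is then unique up
to a nonzero scalar. -/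
def IsResidualConic (F : MvPolynomial (Fin 4) ℂ) (ℓ H : Submodule ℂ (Fin 4 → ℂ))
    (q : MvPolynomial (Fin 4) ℂ) : Prop :=
  q.IsHomogeneous 2 ∧ (∃ v ∈ H, MvPolynomial.eval v q ≠ 0) ∧
    ∃ m : Module.Dual ℂ (Fin 4 → ℂ), H ⊓ LinearMap.ker m = ℓ ∧
      ∀ v ∈ H, MvPolynomial.eval v F = m v ^ 2 * MvPolynomial.eval v q

/-- The lines on the surface `F = 0` that meet the conic `q = 0` in the plane `H`, that is, have a
point of `ℙ³` in common with it. -/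
def linesMeetingConic (F : MvPolynomial (Fin 4) ℂ) (H : Submodule ℂ (Fin 4 → ℂ))
    (q : MvPolynomial (Fin 4) ℂ) : Set (Submodule ℂ (Fin 4 → ℂ)) :=
  {L | L ∈ linesOn F ∧ ∃ v : Fin 4 → ℂ, v ≠ 0 ∧ v ∈ L ∧ v ∈ H ∧ MvPolynomial.eval v q = 0}

open Polynomial Matrix

/-! In coordinates with ℓ₀ = {x = y = 0}, the plane y = t x cuts S in x² times a conic whose
coefficients are polynomials in t, of degree at most 4 for x², 3 for xz and xw, and 2 for z², zw and
w². The discriminant of this family has degree at most 8. It is nonzero because S has finitely many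
lines, and its degree is exactly 8 once the conic in the plane x = 0 is smooth. A line on S other
than ℓ₀ either misses ℓ₀, and is then a section of the conic bundle, or lies in exactly one plane
through ℓ₀. A general conic can meet a line of the second kind only on ℓ₀, and then only at a base
point, that is, a point of ℓ₀ common to all conics. So it suffices to bound 1 + (sections) + (lines
through base points).

Sections and base points are isotropic vectors of the Gram matrix of the family. At a root p of the
discriminant, `hasWords` attaches a binary word to each isotropic vector; the product of two vectors
vanishes at p at least as often as their words agree. Geometrically, a word records which components
of the degenerate fibre the section runs through. Taken over all roots, the words become sign
vectors with at most 8 entries (`exists_sign_vectors`). The product of two sections is a nonzero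
polynomial of degree at most 4, so their sign vectors have scalar product at most 0; for a section
and a base point the bounds are 3 and -2, for two base points 2 and -4. Euclidean geometry then
allows at most 16, 8 or 4 sections if there are 0, 1 or 2 base points.

The lines through a base point are counted by roots of the discriminant or of a factor of it: at
most 8 if the base point is alone, at most 6 through each of two. The total is at most 17 in every
case, within the claimed 19. -/

/-! ### Ternary quadratic forms over ℂ[X] near a point p, with π = X - p: normal forms and words. -/

theorem bilin_comm {R : Type*} [CommRing R] {S : Matrix (Fin 3) (Fin 3) R} (hS : Sᵀ = S)
    (x y : Fin 3 → R) : x ⬝ᵥ S *ᵥ y = y ⬝ᵥ S *ᵥ x := by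
  rw [dotProduct_mulVec, ← mulVec_transpose, hS, dotProduct_comm]

/-- A singular nonzero complex symmetric `3 × 3` matrix is congruent to the matrix of `2xy` or
of `x²`. -/
theorem exists_congr_normal_form (S : Matrix (Fin 3) (Fin 3) ℂ) (hS : Sᵀ = S) (h0 : S ≠ 0)
    (hdet : S.det = 0) : ∃ U : Matrix (Fin 3) (Fin 3) ℂ, U.det ≠ 0 ∧
      (Uᵀ * S * U = !![0, 1, 0; 1, 0, 0; 0, 0, 0] ∨ Uᵀ * S * U = !![1, 0, 0; 0, 0, 0; 0, 0, 0]) := by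
  have sym := bilin_comm hS
  have hv : ∃ v, v ⬝ᵥ S *ᵥ v = 1 := by
    have h1 : ∃ v, v ⬝ᵥ S *ᵥ v ≠ 0 := by
      by_contra! hc
      apply h0
      have key : ∀ x y : Fin 3 → ℂ, x ⬝ᵥ S *ᵥ y = 0 := by
        intro x y
        have := hc (x + y)
        simp only [mulVec_add, dotProduct_add, add_dotProduct, hc] at this
        rw [sym y x] at this
        linear_combination this / 2
      ext i j
      have := key (Pi.single i 1) (Pi.single j 1)
      simpa using this
    obtain ⟨v, hv⟩ := h1
    obtain ⟨c, hc⟩ := IsAlgClosed.exists_pow_nat_eq (v ⬝ᵥ S *ᵥ v)⁻¹ (n := 2) (by norm_num)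
    refine ⟨c • v, ?_⟩
    simp only [mulVec_smul, dotProduct_smul, smul_dotProduct, smul_eq_mul]
    rw [← mul_assoc, ← pow_two, hc, inv_mul_cancel₀ hv]
  obtain ⟨v, hv⟩ := hv
  obtain ⟨e, he, hSe⟩ := exists_mulVec_eq_zero_iff.mpr hdet
  have hg : ∃ g : Fin 3 → ℂ, (Matrix.of ![v, g, e]).det ≠ 0 := by
    by_contra! hc
    apply he
    -- These three equations say v × e = 0. Together with Sv · v = 1 and Sv · e = 0 this forces e =
    -- 0.
    have e1 := hc ![1, 0, 0]
    have e2 := hc ![0, 1, 0]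
    have e3 := hc ![0, 0, 1]
    simp [det_fin_three] at e1 e2 e3
    have hse : v ⬝ᵥ S *ᵥ e = 0 := by rw [hSe]; simp
    rw [sym] at hse
    simp only [dotProduct, Fin.sum_univ_three] at hv hse
    funext j
    fin_cases j
    · simp only [Fin.zero_eta, Pi.zero_apply]
      linear_combination (-e 0) * hv + v 0 * hse + (S *ᵥ v) 1 * e3 - (S *ᵥ v) 2 * e2
    · simp only [Fin.mk_one, Pi.zero_apply]
      linear_combination (-e 1) * hv + v 1 * hse - (S *ᵥ v) 0 * e3 + (S *ᵥ v) 2 * e1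
    · simp only [Fin.reduceFinMk, Pi.zero_apply]
      linear_combination (-e 2) * hv + v 2 * hse + (S *ᵥ v) 0 * e2 - (S *ᵥ v) 1 * e1
  obtain ⟨g0, hg0⟩ := hg
  obtain ⟨g, hg, hvg⟩ : ∃ g : Fin 3 → ℂ, (Matrix.of ![v, g, e]).det ≠ 0 ∧ v ⬝ᵥ S *ᵥ g = 0 := by
    refine ⟨g0 - (v ⬝ᵥ S *ᵥ g0) • v, ?_, ?_⟩
    · convert hg0 using 1
      simp [det_fin_three]
      ring
    · simp only [mulVec_sub, mulVec_smul, dotProduct_sub, dotProduct_smul, hv, smul_eq_mul]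
      ring
  have entries : ∀ a b : Fin 3 → ℂ, a ⬝ᵥ S *ᵥ e = 0 ∧ e ⬝ᵥ S *ᵥ b = 0 := by
    intro a b
    refine ⟨by simp [hSe], by rw [sym]; simp [hSe]⟩
  have tri : ∀ a b c : Fin 3 → ℂ, ∀ i j,
      ((Matrix.of ![a, b, c]) * S * (Matrix.of ![a, b, c])ᵀ) i j
        = (![a, b, c] i) ⬝ᵥ S *ᵥ (![a, b, c] j) := by
    intro a b c i j
    rw [Matrix.mul_mul_apply]
    rfl
  by_cases hd : g ⬝ᵥ S *ᵥ g = 0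
  · refine ⟨(Matrix.of ![v, g, e])ᵀ, by rwa [det_transpose], Or.inr ?_⟩
    ext i j
    rw [transpose_transpose, tri]
    have h2 := sym g v
    fin_cases i <;> fin_cases j <;> simp [hv, hvg, hd, hSe, h2, (entries 0 v).2, (entries 0 g).2]
  -- With c² Q(g) = -1 and Q(v) = 1 the vectors v ± c g are isotropic; the factor 1/2 below makes
  -- them pair to 1.
  · obtain ⟨c, hc⟩ := IsAlgClosed.exists_pow_nat_eq (-(g ⬝ᵥ S *ᵥ g)⁻¹) (n := 2) (by norm_num)
    have hc0 : c ≠ 0 := by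
      rintro rfl
      have := inv_ne_zero hd
      apply this
      linear_combination hc
    have hcg : c ^ 2 * (g ⬝ᵥ S *ᵥ g) = -1 := by
      rw [hc]; field_simp
    have h2 := sym g v
    refine ⟨(Matrix.of ![v + c • g, (1 / 2 : ℂ) • (v - c • g), e])ᵀ, ?_, Or.inl ?_⟩
    · rw [det_transpose]
      have : (Matrix.of ![v + c • g, (1 / 2 : ℂ) • (v - c • g), e]).det
          = -c * (Matrix.of ![v, g, e]).det := by
        simp [det_fin_three]
        ring
      rw [this]
      exact mul_ne_zero (neg_ne_zero.mpr hc0) hg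
    · ext i j
      rw [transpose_transpose, tri]
      fin_cases i <;> fin_cases j <;>
        simp [hv, hvg, hSe, h2, mulVec_add, mulVec_sub, mulVec_smul, (entries 0 v).2,
          (entries 0 g).2]
      all_goals try linear_combination hcg
      all_goals try linear_combination hcg / 2
      all_goals try linear_combination -hcg / 2

/-- The number of positions where two binary words agree. -/
def agreement {m : ℕ} (a b : Fin m → Bool) : ℕ := (Finset.univ.filter fun i => a i = b i).card

/-- `v` is isotropic for the quadratic form with matrix `M`, and does not vanish at `p`. -/
def IsIsotropicAt (M : Matrix (Fin 3) (Fin 3) ℂ[X]) (p : ℂ) (v : Fin 3 → ℂ[X]) : Prop :=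
  v ⬝ᵥ M *ᵥ v = 0 ∧ ∃ i, (v i).eval p ≠ 0

/-- The isotropic vectors can be labelled by binary words, of length `m` or shorter by a multiple
of four, whose agreement bounds from below the vanishing order at `p` of the bilinear form. -/
def HasWords (M : Matrix (Fin 3) (Fin 3) ℂ[X]) (p : ℂ) (m : ℕ) : Prop :=
  ∃ m' e, m = m' + 4 * e ∧ ∃ w : (Fin 3 → ℂ[X]) → Fin m' → Bool,
    ∀ v v', IsIsotropicAt M p v → IsIsotropicAt M p v' →
      (X - C p) ^ (2 * e + agreement (w v) (w v')) ∣ v ⬝ᵥ M *ᵥ v'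

theorem HasWords.of_congr {M : Matrix (Fin 3) (Fin 3) ℂ[X]} {p : ℂ} {m : ℕ}
    (U : Matrix (Fin 3) (Fin 3) ℂ) (hU : U.det ≠ 0)
    (h : HasWords ((U.map C)ᵀ * M * U.map C) p m) : HasWords M p m := by
  obtain ⟨m', e, hm, w, hw⟩ := h
  set V := U⁻¹ with hV
  have hUV : U * V = 1 := mul_nonsing_inv U (Ne.isUnit hU)
  have hUV' : U.map (C : ℂ →+* ℂ[X]) * V.map (C : ℂ →+* ℂ[X]) = 1 := by
    rw [← Matrix.map_mul, hUV]; simp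
  have back : ∀ v : Fin 3 → ℂ[X], U.map (C : ℂ →+* ℂ[X]) *ᵥ (V.map (C : ℂ →+* ℂ[X]) *ᵥ v) = v := by
    intro v; rw [mulVec_mulVec, hUV', one_mulVec]
  have form : ∀ v v' : Fin 3 → ℂ[X], (V.map (C : ℂ →+* ℂ[X]) *ᵥ v) ⬝ᵥ
      ((U.map (C : ℂ →+* ℂ[X]))ᵀ * M * U.map (C : ℂ →+* ℂ[X])) *ᵥ (V.map (C : ℂ →+* ℂ[X]) *ᵥ v')
        = v ⬝ᵥ M *ᵥ v' := by
    intro v v'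
    rw [← mulVec_mulVec, back, ← mulVec_mulVec, dotProduct_mulVec, vecMul_transpose, back]
  have iso : ∀ v, IsIsotropicAt M p v →
      IsIsotropicAt ((U.map C)ᵀ * M * U.map C) p (V.map (C : ℂ →+* ℂ[X]) *ᵥ v) := by
    rintro v ⟨h1, h2⟩
    refine ⟨by rw [form, h1], ?_⟩
    by_contra! hc
    obtain ⟨i, hi⟩ := h2
    apply hi
    conv_lhs => rw [← back v]
    rw [mulVec, dotProduct, eval_finsetSum]
    exact Finset.sum_eq_zero fun j _ => by rw [eval_mul, hc j, mul_zero]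
  refine ⟨m', e, hm, fun v => w (V.map (C : ℂ →+* ℂ[X]) *ᵥ v), fun v v' hv hv' => ?_⟩
  have := hw _ _ (iso v hv) (iso v' hv')
  rwa [form] at this

/-- The two threshold words differ exactly at the positions a, …, b - 1. -/
theorem agreement_threshold {m a b : ℕ} (hb : b ≤ m) (hab : a ≤ b) :
    agreement (fun i : Fin m => decide ((i : ℕ) < a)) (fun i : Fin m => decide ((i : ℕ) < b))
      = m - (b - a) := by
  have h1 : (Finset.univ.filter fun i : Fin m =>
      ¬ (decide ((i : ℕ) < a) = decide ((i : ℕ) < b))).card = b - a := by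
    have : (Finset.univ.filter fun i : Fin m =>
      ¬ (decide ((i : ℕ) < a) = decide ((i : ℕ) < b))).map Fin.valEmbedding = Finset.Ico a b := by
      ext x
      simp only [Finset.mem_map, Finset.mem_filter, Finset.mem_univ, true_and, Finset.mem_Ico,
        Fin.valEmbedding_apply, decide_eq_decide]
      constructor
      · rintro ⟨i, hi, rfl⟩; omega
      · rintro ⟨h1, h2⟩; exact ⟨⟨x, by omega⟩, by simp only; omega, rfl⟩
    rw [← Finset.card_map, this, Nat.card_Ico]
  have h2 := Finset.card_filter_add_card_filter_not (s := (Finset.univ : Finset (Fin m)))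
    (fun i : Fin m => decide ((i : ℕ) < a) = decide ((i : ℕ) < b))
  rw [h1, Finset.card_univ, Fintype.card_fin] at h2
  simp only [agreement] at h2 ⊢
  omega

theorem agreement_comm {m : ℕ} (a b : Fin m → Bool) : agreement a b = agreement b a := by
  unfold agreement
  simp only [eq_comm]

/-- If the form factors modulo `π ^ m`, the words are given by the order of one of the factors. -/
theorem HasWords.of_factor {M : Matrix (Fin 3) (Fin 3) ℂ[X]} {p : ℂ} {m : ℕ}
    (hM : Mᵀ = M) (x y : Fin 3 → ℂ[X]) (R : Matrix (Fin 3) (Fin 3) ℂ[X])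
    (h : M = vecMulVec x y + vecMulVec y x + (X - C p) ^ m • R) : HasWords M p m := by
  have form : ∀ v v' : Fin 3 → ℂ[X], v ⬝ᵥ M *ᵥ v'
      = (v ⬝ᵥ x) * (v' ⬝ᵥ y) + (v ⬝ᵥ y) * (v' ⬝ᵥ x) + (X - C p) ^ m * (v ⬝ᵥ R *ᵥ v') := by
    intro v v'
    rw [h]
    simp only [add_mulVec, vecMulVec_mulVec, smul_mulVec, dotProduct_add, dotProduct_smul,
      smul_eq_mul, op_smul_eq_smul]
    rw [dotProduct_comm y v', dotProduct_comm x v']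
    ring
  have pr : Prime (X - C p) := prime_X_sub_C p
  have hth : ∀ v, ∃ a ≤ m, IsIsotropicAt M p v →
      (X - C p) ^ a ∣ v ⬝ᵥ x ∧ (X - C p) ^ (m - a) ∣ v ⬝ᵥ y := by
    intro v
    by_cases hv : IsIsotropicAt M p v
    · have h1 : (X - C p) ^ m ∣ (v ⬝ᵥ x) * (v ⬝ᵥ y) := by
        have h2 := hv.1
        rw [form] at h2
        have h3 : (X - C p) ^ m ∣ C 2 * ((v ⬝ᵥ x) * (v ⬝ᵥ y)) :=
          ⟨-(v ⬝ᵥ R *ᵥ v), by rw [show (C (2 : ℂ)) = (2 : ℂ[X]) from rfl]; linear_combination h2⟩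
        exact (IsUnit.dvd_mul_left (isUnit_C.mpr (by norm_num))).mp h3
      obtain ⟨d1, d2, hd1, hd2, hd⟩ := exists_dvd_and_dvd_of_dvd_mul h1
      obtain ⟨a, ha, hda⟩ := (dvd_prime_pow pr m).mp ⟨d2, hd⟩
      refine ⟨a, ha, fun _ => ⟨hda.symm.dvd.trans hd1, ?_⟩⟩
      refine dvd_trans ?_ hd2
      have hd0 : d1 ≠ 0 := by
        rintro rfl
        exact pow_ne_zero m pr.ne_zero (by rw [hd, zero_mul])
      refine (mul_dvd_mul_iff_left hd0).mp ?_
      rw [← hd, ← Nat.add_sub_cancel' ha, pow_add, Nat.add_sub_cancel_left]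
      exact mul_dvd_mul_right hda.dvd _
    · exact ⟨0, Nat.zero_le _, fun h => absurd h hv⟩
  choose a ha hth using hth
  -- The word of v is `true` repeated a(v) times, then `false`. If a(v) ≤ a(v'), the product x(v)
  -- y(v') has order at least a(v) + m - a(v'), which is the agreement of the words.
  refine ⟨m, 0, by simp, fun v i => decide ((i : ℕ) < a v), ?_⟩
  have main : ∀ v v', IsIsotropicAt M p v → IsIsotropicAt M p v' → a v ≤ a v' →
      (X - C p) ^ (m - (a v' - a v)) ∣ v ⬝ᵥ M *ᵥ v' := by
    intro v v' hv hv' hle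
    rw [form]
    have := ha v
    have := ha v'
    refine dvd_add (dvd_add ?_ ?_) ?_
    · have := mul_dvd_mul (hth v hv).1 (hth v' hv').2
      rw [← pow_add] at this
      exact (pow_dvd_pow _ (by omega)).trans this
    · have := mul_dvd_mul (hth v hv).2 (hth v' hv').1
      rw [← pow_add] at this
      exact (pow_dvd_pow _ (by omega)).trans this
    · exact (pow_dvd_pow _ (by omega)).trans (dvd_mul_right _ _)
  intro v v' hv hv'
  rw [mul_zero, zero_add]
  rcases le_total (a v) (a v') with hle | hle
  · rw [agreement_threshold (ha v') hle]
    exact main v v' hv hv' hle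
  · rw [agreement_comm, agreement_threshold (ha v) hle]
    have := main v' v hv' hv hle
    rwa [bilin_comm hM] at this

/-- Expansion of the determinant at the degenerate matrix xyᵀ + yxᵀ, whose adjugate is -(x × y)(x ×
y)ᵀ. The linear term in r is the obstruction to lifting a factorization. -/
theorem det_vecMulVec_add_smul {R : Type*} [CommRing R] (x y : Fin 3 → R)
    (N : Matrix (Fin 3) (Fin 3) R) (r : R) :
    (vecMulVec x y + vecMulVec y x + r • N).det
      = r * (-(crossProduct x y ⬝ᵥ N *ᵥ crossProduct x y)
        + r * (x ⬝ᵥ N.adjugate *ᵥ y + y ⬝ᵥ N.adjugate *ᵥ x + r * N.det)) := by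
  simp only [det_fin_three, adjugate_fin_three, crossProduct, dotProduct, mulVec,
    Fin.sum_univ_three, vecMulVec, Matrix.add_apply, Matrix.smul_apply, of_apply, smul_eq_mul,
    LinearMap.mk₂_apply, cons_val]
  ring

/-- A symmetric matrix congruent to the matrix of `2xy` modulo `π` is a product of two linear
forms modulo any power of `π` dividing its determinant. -/
theorem exists_factor_mod_pow {M : Matrix (Fin 3) (Fin 3) ℂ[X]} (hM : Mᵀ = M) {p : ℂ}
    (h0 : M.map (eval p) = !![0, 1, 0; 1, 0, 0; 0, 0, 0]) (j : ℕ)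
    (hdet : (X - C p) ^ (j + 1) ∣ M.det) :
    ∃ (a b : Fin 3 → ℂ[X]) (R : Matrix (Fin 3) (Fin 3) ℂ[X]), Rᵀ = R ∧
      M = vecMulVec (![1, 0, 0] + (X - C p) • a) (![0, 1, 0] + (X - C p) • b)
        + vecMulVec (![0, 1, 0] + (X - C p) • b) (![1, 0, 0] + (X - C p) • a)
        + (X - C p) ^ (j + 1) • R := by
  induction j with
  | zero =>
    have hd : ∀ i j, ∃ r, M i j = C ((!![0, 1, 0; 1, 0, 0; 0, 0, 0] : Matrix _ _ ℂ) i j)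
        + (X - C p) * r := by
      intro i j
      have h1 : (X - C p) ∣ M i j - C ((M i j).eval p) := X_sub_C_dvd_sub_C_eval
      have h2 : (M i j).eval p = (!![0, 1, 0; 1, 0, 0; 0, 0, 0] : Matrix _ _ ℂ) i j := by
        rw [← h0]; rfl
      obtain ⟨r, hr⟩ := h1
      exact ⟨r, by rw [← h2, ← hr]; ring⟩
    choose R hR using hd
    refine ⟨0, 0, Matrix.of R, ?_, ?_⟩
    · ext1 i j
      have h1 : M i j = M j i := by conv_lhs => rw [← hM, transpose_apply]
      have h2 : (X - C p) * R i j = (X - C p) * R j i := by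
        have e1 := hR i j
        have e2 := hR j i
        rw [h1, e2] at e1
        have : (!![0, 1, 0; 1, 0, 0; 0, 0, 0] : Matrix (Fin 3) (Fin 3) ℂ) i j
          = (!![0, 1, 0; 1, 0, 0; 0, 0, 0] : Matrix (Fin 3) (Fin 3) ℂ) j i := by
          fin_cases i <;> fin_cases j <;> rfl
        rw [this] at e1
        exact (add_left_cancel e1).symm
      exact (mul_left_cancel₀ (X_sub_C_ne_zero p) h2).symm
    · ext1 i j
      rw [hR]
      fin_cases i <;> fin_cases j <;> simp [vecMulVec]
  | succ j ih =>
    obtain ⟨a, b, R, hRs, hR⟩ := ih ((pow_dvd_pow _ (by omega)).trans hdet)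
    have hsym : ∀ i k, R i k = R k i := fun i k => by conv_lhs => rw [← hRs, transpose_apply]
    set x : Fin 3 → ℂ[X] := ![1, 0, 0] + (X - C p) • a with hx
    set y : Fin 3 → ℂ[X] := ![0, 1, 0] + (X - C p) • b with hy
    -- The determinant has one factor π more than π ^ (j + 1), so π divides the linear term of the
    -- expansion; as x × y ≡ (0, 0, 1) modulo π, that term is -R₂₂.
    have h1 : (X - C p) ∣ R 2 2 := by
      rw [hR, det_vecMulVec_add_smul, pow_succ _ (j + 1)] at hdet
      have h2 := (mul_dvd_mul_iff_left (pow_ne_zero _ (X_sub_C_ne_zero p))).mp hdet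
      rw [dvd_iff_isRoot, IsRoot.def] at h2 ⊢
      have h3 : ∀ i, (crossProduct x y i).eval p = ![0, 0, 1] i := by
        intro i
        fin_cases i <;> simp [crossProduct, hx, hy, -Matrix.smul_cons, Pi.smul_apply, vecHead, vecTail]
      rw [eval_add, eval_mul, eval_pow] at h2
      simpa [dotProduct, mulVec, Fin.sum_univ_three, h3] using h2
    obtain ⟨r, hr⟩ := h1
    -- Modulo π, the remaining entries of R form e₀ηᵀ + ηe₀ᵀ + e₁ξᵀ + ξe₁ᵀ, so correcting the two
    -- factors by multiples of ξ and η absorbs them.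
    set η : Fin 3 → ℂ[X] := ![C (1 / 2) * R 0 0, R 0 1, R 0 2] with hη
    set ξ : Fin 3 → ℂ[X] := ![0, C (1 / 2) * R 1 1, R 1 2] with hξ
    have half : (C (1 / 2 : ℂ) : ℂ[X]) * 2 = 1 := by
      rw [show (2 : ℂ[X]) = C 2 from rfl, ← C_mul]; norm_num
    refine ⟨a + (X - C p) ^ j • ξ, b + (X - C p) ^ j • η,
      Matrix.of ![![0, 0, 0], ![0, 0, 0], ![0, 0, r]] - (vecMulVec a η + vecMulVec η a
        + vecMulVec b ξ + vecMulVec ξ b) - (X - C p) ^ j • (vecMulVec ξ η + vecMulVec η ξ), ?_, ?_⟩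
    · ext1 i k
      fin_cases i <;> fin_cases k <;>
        simp only [vecMulVec, transpose_apply, Matrix.add_apply, Matrix.sub_apply,
          Matrix.smul_apply, of_apply, smul_eq_mul, cons_val, Fin.zero_eta, Fin.mk_one,
          Fin.reduceFinMk] <;> ring
    · ext1 i k
      have e := congrFun (congrFun hR i) k
      rw [e]
      have s1 := hsym 1 0
      have s2 := hsym 2 0
      have s3 := hsym 2 1
      fin_cases i <;> fin_cases k <;>
        simp only [vecMulVec, hx, hy, hη, hξ, Matrix.add_apply, Matrix.sub_apply,
          Matrix.smul_apply, of_apply, smul_eq_mul, cons_val, Pi.add_apply, Pi.smul_apply,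
          Fin.zero_eta, Fin.mk_one, Fin.reduceFinMk, s1, s2, s3, hr]
      · linear_combination (-(X - C p) ^ (j + 1) * R 0 0) * half
      · ring
      · ring
      · ring
      · linear_combination (-(X - C p) ^ (j + 1) * R 1 1) * half
      · ring
      · ring
      · ring
      · ring

theorem HasWords.of_rank_two {M : Matrix (Fin 3) (Fin 3) ℂ[X]} (hM : Mᵀ = M) {p : ℂ}
    (h0 : M.map (eval p) = !![0, 1, 0; 1, 0, 0; 0, 0, 0]) {m : ℕ} (hm : m ≠ 0)
    (hdet : (X - C p) ^ m ∣ M.det) : HasWords M p m := by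
  obtain ⟨j, rfl⟩ := Nat.exists_eq_succ_of_ne_zero hm
  obtain ⟨a, b, R, -, hR⟩ := exists_factor_mod_pow hM h0 j hdet
  exact HasWords.of_factor hM _ _ R hR

theorem agreement_cons {m : ℕ} (x : Bool) (a b : Fin m → Bool) :
    agreement (Fin.cons x a : Fin (m + 1) → Bool) (Fin.cons x b) = agreement a b + 1 := by
  unfold agreement
  rw [Fin.univ_succ, Finset.filter_cons]
  simp [Finset.filter_map]

/-- If `M ≡ diag(1, 0, 0)` modulo `π`, the substitution `x = π x'` divides the form by `π`. -/
theorem exists_rescaling {M : Matrix (Fin 3) (Fin 3) ℂ[X]} (hM : Mᵀ = M) {p : ℂ}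
    (h0 : M.map (eval p) = !![1, 0, 0; 0, 0, 0; 0, 0, 0]) :
    ∃ N : Matrix (Fin 3) (Fin 3) ℂ[X], Nᵀ = N ∧ N 0 0 = (X - C p) * M 0 0 ∧
      M.det = (X - C p) * N.det ∧
      ∃ f : (Fin 3 → ℂ[X]) → (Fin 3 → ℂ[X]),
        (∀ v, IsIsotropicAt M p v → IsIsotropicAt N p (f v)) ∧
        ∀ v v', IsIsotropicAt M p v → IsIsotropicAt M p v' →
          v ⬝ᵥ M *ᵥ v' = (X - C p) * (f v ⬝ᵥ N *ᵥ f v') := by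
  have hsym : ∀ i k, M i k = M k i := fun i k => by conv_lhs => rw [← hM, transpose_apply]
  have hp : (X - C p : ℂ[X]) ≠ 0 := X_sub_C_ne_zero p
  have ev : ∀ i j, (M i j).eval p = (!![1, 0, 0; 0, 0, 0; 0, 0, 0] : Matrix _ _ ℂ) i j := by
    intro i j; rw [← h0]; rfl
  have hdv : ∀ i j, (!![1, 0, 0; 0, 0, 0; 0, 0, 0] : Matrix (Fin 3) (Fin 3) ℂ) i j = 0 →
      ∃ r, M i j = (X - C p) * r := by
    intro i j h
    rw [← ev] at h
    exact dvd_iff_isRoot.mpr h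
  obtain ⟨a, ha⟩ := hdv 1 1 rfl
  obtain ⟨b, hb⟩ := hdv 1 2 rfl
  obtain ⟨c, hc⟩ := hdv 2 2 rfl
  obtain ⟨d, hd⟩ := hdv 0 1 rfl
  obtain ⟨e, he⟩ := hdv 0 2 rfl
  have form : ∀ v v' : Fin 3 → ℂ[X], v ⬝ᵥ M *ᵥ v' =
      M 0 0 * (v 0 * v' 0) + (X - C p) * (a * (v 1 * v' 1) + b * (v 1 * v' 2 + v 2 * v' 1)
        + c * (v 2 * v' 2) + d * (v 0 * v' 1 + v 1 * v' 0) + e * (v 0 * v' 2 + v 2 * v' 0)) := by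
    intro v v'
    simp only [dotProduct, mulVec, Fin.sum_univ_three, hsym 1 0, hsym 2 0, hsym 2 1, ha, hb, hc,
      hd, he]
    ring
  -- Modulo π the isotropy condition reads v₀² = 0.
  have hv0 : ∀ v, ∃ r, IsIsotropicAt M p v → v 0 = (X - C p) * r := by
    intro v
    by_cases h : IsIsotropicAt M p v
    · have h1 := congrArg (eval p) h.1
      rw [form] at h1
      have h2 : (v 0).eval p = 0 := by simpa [ev] using h1
      obtain ⟨r, hr⟩ := dvd_iff_isRoot.mpr h2
      exact ⟨r, fun _ => hr⟩
    · exact ⟨0, fun h' => absurd h' h⟩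
  choose r hr using hv0
  set N : Matrix (Fin 3) (Fin 3) ℂ[X] :=
    !![(X - C p) * M 0 0, (X - C p) * d, (X - C p) * e; (X - C p) * d, a, b;
      (X - C p) * e, b, c] with hN
  have formN : ∀ v v', IsIsotropicAt M p v → IsIsotropicAt M p v' →
      v ⬝ᵥ M *ᵥ v' = (X - C p) * ((![r v, v 1, v 2] : Fin 3 → ℂ[X]) ⬝ᵥ N *ᵥ ![r v', v' 1, v' 2]) := by
    intro v v' hv hv'
    rw [form, hr v hv, hr v' hv']
    simp only [dotProduct, mulVec, Fin.sum_univ_three, hN, of_apply, cons_val]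
    ring
  refine ⟨N, ?_, rfl, ?_, fun v => ![r v, v 1, v 2], ?_, formN⟩
  · ext1 i j
    fin_cases i <;> fin_cases j <;> rfl
  · rw [det_fin_three, det_fin_three]
    simp only [hN, of_apply, cons_val, hsym 1 0, hsym 2 0, hsym 2 1, ha, hb, hc, hd, he]
    ring
  · intro v hv
    refine ⟨?_, ?_⟩
    · have := formN v v hv hv
      rw [hv.1] at this
      exact (mul_eq_zero.mp this.symm).resolve_left hp
    · obtain ⟨i, hi⟩ := hv.2
      fin_cases i
      · refine absurd ?_ hi
        simp [hr v hv]
      · exact ⟨1, hi⟩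
      · exact ⟨2, hi⟩

/-- A form which does not vanish modulo `π` and whose discriminant has order `m` has words. -/
theorem hasWords (m : ℕ) : ∀ {M : Matrix (Fin 3) (Fin 3) ℂ[X]} {p : ℂ}, Mᵀ = M →
    M.map (eval p) ≠ 0 → ∀ g : ℂ[X], g.eval p ≠ 0 → M.det = (X - C p) ^ m * g →
    HasWords M p m := by
  induction m using Nat.strong_induction_on with
  | _ m ih =>
  intro M p hM hMp g hg hdet
  rcases Nat.eq_zero_or_pos m with rfl | hm
  · exact ⟨0, 0, rfl, fun _ => Fin.elim0, fun v v' _ _ => by simp [agreement]⟩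
  have hsing : (M.map (eval p)).det = 0 := by
    have h1 := congrArg (eval p) hdet
    rw [← coe_evalRingHom, RingHom.map_det] at h1
    rw [← coe_evalRingHom] at *
    rw [RingHom.mapMatrix_apply] at h1
    rw [h1]
    simp [hm.ne']
  have hS : (M.map (eval p))ᵀ = M.map (eval p) := by rw [← transpose_map, hM]
  obtain ⟨U, hU, hcase⟩ := exists_congr_normal_form _ hS hMp hsing
  refine HasWords.of_congr U hU ?_
  set K := (U.map C)ᵀ * M * U.map C with hK
  have hKs : Kᵀ = K := by
    rw [hK, transpose_mul, transpose_mul, transpose_transpose, hM, Matrix.mul_assoc]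
  have hKp : K.map (eval p) = Uᵀ * M.map (eval p) * U := by
    rw [hK, ← coe_evalRingHom, Matrix.map_mul, Matrix.map_mul, transpose_map]
    have : (U.map C).map (evalRingHom p) = U := by ext i j; simp
    rw [this]
  have hKdet : K.det = (X - C p) ^ m * (C (U.det ^ 2) * g) := by
    rw [hK, det_mul, det_mul, det_transpose, hdet]
    have : (U.map (C : ℂ →+* ℂ[X])).det = C U.det := by
      rw [RingHom.map_det, RingHom.mapMatrix_apply]
    rw [this, C_pow]
    ring
  have hg' : (C (U.det ^ 2) * g).eval p ≠ 0 := by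
    rw [eval_mul, eval_C]
    exact mul_ne_zero (pow_ne_zero _ hU) hg
  clear_value K
  set g' := C (U.det ^ 2) * g with hg'd
  clear_value g'
  rcases hcase with h | h
  · rw [← hKp] at h
    exact HasWords.of_rank_two hKs h hm.ne' ⟨_, hKdet⟩
  · rw [← hKp] at h
    obtain ⟨N, hNs, hN00, hNdet, f, hf, hfb⟩ := exists_rescaling hKs h
    have hp : (X - C p : ℂ[X]) ≠ 0 := X_sub_C_ne_zero p
    have hNdet' : N.det = (X - C p) ^ (m - 1) * g' := by
      apply mul_left_cancel₀ hp
      rw [← hNdet, hKdet, ← mul_assoc, ← pow_succ', Nat.sub_add_cancel hm]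
    by_cases hN0 : N.map (eval p) = 0
    · have hdv : ∀ i j, ∃ r, N i j = (X - C p) * r := fun i j =>
        dvd_iff_isRoot.mpr (congrFun (congrFun hN0 i) j)
      choose L hL using hdv
      have hNL : N = (X - C p) • Matrix.of L := by ext1 i j; rw [hL]; rfl
      have hLs : (Matrix.of L)ᵀ = Matrix.of L := by
        ext1 i j
        apply mul_left_cancel₀ hp
        simp only [transpose_apply, of_apply]
        rw [← hL, ← hL]
        conv_rhs => rw [← hNs, transpose_apply]
      -- The substitution followed by both divisions returns the corner entry of K, which is 1 at p.
      -- Hence L is nonzero at p and the induction hypothesis applies.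
      have hL00 : L 0 0 = K 0 0 := by
        apply mul_left_cancel₀ hp
        rw [← hL, hN00]
      have hLp : (Matrix.of L).map (eval p) ≠ 0 := by
        intro hc
        have h1 := congrFun (congrFun hc 0) 0
        have h2 := congrFun (congrFun h 0) 0
        simp only [map_apply, of_apply, hL00] at h1 h2
        rw [h1] at h2
        simp at h2
      have hdL : (X - C p) ^ (m - 1) * g' = (X - C p) ^ 3 * (Matrix.of L).det := by
        rw [← hNdet', hNL, det_smul, Fintype.card_fin]
      -- Dividing a 3 × 3 matrix by π removes π³ from its determinant, whose order here is m - 1.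
      have hm4 : 4 ≤ m := by
        by_contra! hlt
        obtain ⟨k, hk⟩ : ∃ k, 3 = (m - 1) + (k + 1) := ⟨3 - m, by omega⟩
        rw [show (X - C p : ℂ[X]) ^ 3 = (X - C p) ^ (m - 1) * (X - C p) ^ (k + 1) by
          rw [← pow_add, ← hk], mul_assoc] at hdL
        have h1 := mul_left_cancel₀ (pow_ne_zero _ hp) hdL
        apply hg'
        rw [h1]
        simp
      have hLdet : (Matrix.of L).det = (X - C p) ^ (m - 4) * g' := by
        apply mul_left_cancel₀ (pow_ne_zero 3 hp)
        rw [← hdL, ← mul_assoc, ← pow_add]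
        congr 2
        omega
      obtain ⟨m', e, hme, w, hw⟩ := ih (m - 4) (by omega) hLs hLp g' hg' hLdet
      have hiso : ∀ v, IsIsotropicAt K p v → IsIsotropicAt (Matrix.of L) p (f v) := by
        intro v hv
        refine ⟨?_, (hf v hv).2⟩
        have h1 := (hf v hv).1
        rw [hNL, smul_mulVec, dotProduct_smul, smul_eq_mul] at h1
        exact (mul_eq_zero.mp h1).resolve_left hp
      -- The determinant has lost π⁴ and every product π²; this is why words may be shorter by 4e at
      -- the price of 2e in the exponent.
      refine ⟨m', e + 1, by omega, fun v => w (f v), fun v v' hv hv' => ?_⟩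
      rw [hfb v v' hv hv', hNL, smul_mulVec, dotProduct_smul, smul_eq_mul, ← mul_assoc,
        ← pow_two, show 2 * (e + 1) + agreement (w (f v)) (w (f v'))
          = 2 + (2 * e + agreement (w (f v)) (w (f v'))) by ring, pow_add]
      exact mul_dvd_mul_left _ (hw _ _ (hiso v hv) (hiso v' hv'))
    · obtain ⟨m', e, hme, w, hw⟩ := ih (m - 1) (by omega) hNs hN0 g' hg' hNdet'
      -- Every product has gained one factor π, which a first letter common to all words records.
      refine ⟨m' + 1, e, by omega, fun v => Fin.cons true (w (f v)), fun v v' hv hv' => ?_⟩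
      rw [hfb v v' hv hv', agreement_cons, ← add_assoc, pow_succ']
      exact mul_dvd_mul_left _ (hw _ _ (hf v hv) (hf v' hv'))

/-! ### From words to sign vectors, and bounds for families of non-acute vectors. -/

/-- The vectors are linearly independent. The positive and negative parts of a vanishing combination
are one vector x, and x · x only involves products V i · V k with i ≠ k, so x = 0. Pairing with t,
which is negative on all V i, then kills every coefficient. -/
theorem card_le_of_obtuse {ι J : Type*} [Fintype ι] [Fintype J] (V : ι → J → ℤ) (t : J → ℤ)
    (ht : ∀ i, V i ⬝ᵥ t < 0) (hV : ∀ i k, i ≠ k → V i ⬝ᵥ V k ≤ 0) :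
    Fintype.card ι ≤ Fintype.card J := by
  have hli : LinearIndependent ℤ V := by
    rw [Fintype.linearIndependent_iff]
    intro g hg
    set x := ∑ i, (g i)⁺ • V i with hx
    set y := ∑ i, (g i)⁻ • V i with hy
    have hxy : x = y := by
      rw [← sub_eq_zero, ← hg, hx, hy, ← Finset.sum_sub_distrib]
      refine Finset.sum_congr rfl fun i _ => ?_
      rw [← sub_smul, posPart_sub_negPart]
    have hxx : x ⬝ᵥ x ≤ 0 := by
      -- The net effect of the three rewrites is to turn only the right factor x into y.
      conv_lhs => rw [hxy]
      conv_lhs => rw [← hxy]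
      conv_lhs => arg 2; rw [hxy]
      rw [hx, hy, sum_dotProduct]
      refine Finset.sum_nonpos fun i _ => ?_
      rw [dotProduct_sum]
      refine Finset.sum_nonpos fun k _ => ?_
      rw [smul_dotProduct, dotProduct_smul, smul_eq_mul, smul_eq_mul]
      by_cases hik : i = k
      · subst hik
        have : (g i)⁺ * (g i)⁻ = 0 := by
          rcases le_total (g i) 0 with h | h
          · rw [posPart_eq_zero.mpr h, zero_mul]
          · rw [negPart_eq_zero.mpr h, mul_zero]
        rw [← mul_assoc, this, zero_mul]
      · exact mul_nonpos_of_nonneg_of_nonpos (posPart_nonneg _)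
          (mul_nonpos_of_nonneg_of_nonpos (negPart_nonneg _) (hV i k hik))
    have hx0 : x = 0 := dotProduct_self_eq_zero.mp
      (le_antisymm hxx (Finset.sum_nonneg fun i _ => mul_self_nonneg _))
    have vanish : ∀ c : ι → ℤ, (∀ i, 0 ≤ c i) → ∑ i, c i • V i = 0 → ∀ i, c i = 0 := by
      intro c hc h i
      have h1 : ∑ i, c i * (V i ⬝ᵥ t) = 0 := by
        have := congrArg (· ⬝ᵥ t) h
        simpa only [sum_dotProduct, smul_dotProduct, smul_eq_mul, zero_dotProduct] using this
      have h2 := (Finset.sum_eq_zero_iff_of_nonpos fun i _ =>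
        mul_nonpos_of_nonneg_of_nonpos (hc i) (ht i).le).mp h1 i (Finset.mem_univ i)
      exact (mul_eq_zero.mp h2).resolve_right (ht i).ne
    intro i
    rw [← posPart_sub_negPart (g i), vanish _ (fun i => posPart_nonneg _) hx0 i,
      vanish _ (fun i => negPart_nonneg _) (hxy.symm.trans hx0) i, sub_zero]
  have := hli.fintype_card_le_finrank
  rwa [Module.finrank_fintype_fun_eq_card] at this

/-- The sign of one fixed coordinate splits the family into two halves, each lying in an open
half-space. -/
theorem card_le_two_mul_of_nonacute {ι J : Type*} [Fintype ι] [Fintype J] [Nonempty J]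
    (V : ι → J → ℤ) (hs : ∀ i j, V i j = 1 ∨ V i j = -1) (hV : ∀ i k, i ≠ k → V i ⬝ᵥ V k ≤ 0) :
    Fintype.card ι ≤ 2 * Fintype.card J := by
  classical
  obtain ⟨j⟩ := ‹Nonempty J›
  have h1 : Fintype.card {i // V i j = -1} ≤ Fintype.card J := by
    refine card_le_of_obtuse (fun i : {i // V i j = -1} => V i) (Pi.single j 1) ?_ ?_
    · intro i
      simp [i.2]
    · intro i k hik
      exact hV i k (fun h => hik (Subtype.ext h))
  have h2 : Fintype.card {i // ¬ V i j = -1} ≤ Fintype.card J := by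
    refine card_le_of_obtuse (fun i : {i // ¬ V i j = -1} => V i) (Pi.single j (-1)) ?_ ?_
    · intro i
      simp [(hs i j).resolve_right i.2]
    · intro i k hik
      exact hV i k (fun h => hik (Subtype.ext h))
  have h3 := Fintype.card_subtype_compl (fun i => V i j = -1)
  have h4 := Fintype.card_subtype_le (fun i => V i j = -1)
  omega

/-- `v` is isotropic and has no zeros. -/
def IsIsotropicPrimitive (M : Matrix (Fin 3) (Fin 3) ℂ[X]) (v : Fin 3 → ℂ[X]) : Prop :=
  ∀ p, IsIsotropicAt M p v

theorem sum_sign_eq {m : ℕ} (a b : Fin m → Bool) :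
    ∑ i, (if a i then (1 : ℤ) else -1) * (if b i then (1 : ℤ) else -1)
      = 2 * (agreement a b : ℤ) - m := by
  have h : ∀ i, (if a i then (1 : ℤ) else -1) * (if b i then (1 : ℤ) else -1)
      = 2 * (if a i = b i then 1 else 0) - 1 := by
    intro i
    cases a i <;> cases b i <;> simp
  simp only [h, Finset.sum_sub_distrib, ← Finset.mul_sum, agreement]
  simp

/-- The words at all roots are concatenated and read as signs. P collects the factors (X - p) ^ (2e)
that divide every product, so |J| = d - 2E. A product of degree D satisfies E + agreement ≤ D, hence
ε v · ε v' = 2 · agreement - |J| ≤ 2D - d; the loss E cancels. -/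
theorem exists_sign_vectors {M : Matrix (Fin 3) (Fin 3) ℂ[X]} (hM : Mᵀ = M)
    (hprim : ∀ p, M.map (eval p) ≠ 0) {d : ℕ} (hd : M.det.natDegree = d) (hd0 : M.det ≠ 0) :
    ∃ (J : Type) (_ : Fintype J) (E : ℕ) (P : ℂ[X]), Fintype.card J + 2 * E = d ∧ P ≠ 0 ∧
      P.natDegree = E ∧ ∃ ε : (Fin 3 → ℂ[X]) → J → ℤ, (∀ v j, ε v j = 1 ∨ ε v j = -1) ∧
        ∀ v v', IsIsotropicPrimitive M v → IsIsotropicPrimitive M v' → v ⬝ᵥ M *ᵥ v' ≠ 0 →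
          P ∣ v ⬝ᵥ M *ᵥ v' ∧ ε v ⬝ᵥ ε v' ≤ 2 * ((v ⬝ᵥ M *ᵥ v').natDegree : ℤ) - d := by
  classical
  have hw : ∀ p, HasWords M p (M.det.rootMultiplicity p) := by
    intro p
    obtain ⟨g, hg, hpg⟩ := exists_eq_pow_rootMultiplicity_mul_and_not_dvd _ hd0 p
    exact hasWords _ hM (hprim p) g (fun h => hpg (dvd_iff_isRoot.mpr h)) hg
  choose m e hme w hw using hw
  set S := M.det.roots.toFinset with hS
  have hsum : ∑ p ∈ S, (m p + 4 * e p) = d := by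
    rw [← hd, ← splits_iff_card_roots.mp (IsAlgClosed.splits M.det),
      ← Multiset.toFinset_sum_count_eq]
    exact Finset.sum_congr rfl fun p _ => by rw [count_roots, hme]
  have hmonic : ∀ k : ℂ → ℕ, (∏ p ∈ S, (X - C p) ^ k p).Monic ∧
      (∏ p ∈ S, (X - C p) ^ k p).natDegree = ∑ p ∈ S, k p := by
    intro k
    have h1 : ∀ p ∈ S, ((X - C p) ^ k p).Monic := fun p _ => (monic_X_sub_C p).pow _
    refine ⟨monic_prod_of_monic _ _ h1, ?_⟩
    rw [natDegree_prod_of_monic _ _ h1]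
    simp
  have hdvd : ∀ (k : ℂ → ℕ) (b : ℂ[X]), (∀ p, (X - C p) ^ k p ∣ b) →
      ∏ p ∈ S, (X - C p) ^ k p ∣ b := by
    intro k b h
    refine Finset.prod_dvd_of_coprime ?_ fun p _ => h p
    intro p _ q _ hpq
    exact (pairwise_coprime_X_sub_C Function.injective_id hpq).pow
  refine ⟨(Σ p : S, Fin (m p)), inferInstance, ∑ p ∈ S, 2 * e p,
    ∏ p ∈ S, (X - C p) ^ (2 * e p), ?_, (hmonic _).1.ne_zero, (hmonic _).2,
    fun v j => if w j.1 v j.2 then 1 else -1, ?_, ?_⟩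
  · rw [Fintype.card_sigma]
    simp only [Fintype.card_fin]
    rw [Finset.sum_coe_sort S m, ← hsum, Finset.sum_add_distrib, Finset.mul_sum]
    congr 1
    exact Finset.sum_congr rfl fun p _ => by ring
  · intro v j
    dsimp only
    split_ifs <;> simp
  · intro v v' hv hv' hb
    have hk := fun p => hw p v v' (hv p) (hv' p)
    refine ⟨hdvd _ _ fun p => (pow_dvd_pow _ (by omega)).trans (hk p), ?_⟩
    have h1 := natDegree_le_of_dvd (hdvd _ _ hk) hb
    rw [(hmonic _).2] at h1
    have h2 : (fun j : (Σ p : S, Fin (m p)) => if w j.1 v j.2 then (1 : ℤ) else -1) ⬝ᵥ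
        (fun j => if w j.1 v' j.2 then (1 : ℤ) else -1)
        = ∑ p ∈ S, (2 * (agreement (w p v) (w p v') : ℤ) - m p) := by
      rw [dotProduct, Fintype.sum_sigma, ← Finset.sum_coe_sort S
        (fun p => 2 * (agreement (w p v) (w p v') : ℤ) - m p)]
      exact Finset.sum_congr rfl fun p _ => sum_sign_eq _ _
    rw [h2]
    have h3 : (∑ p ∈ S, (2 * (agreement (w p v) (w p v') : ℤ) - m p)) + d
        = 2 * ((∑ p ∈ S, (2 * e p + agreement (w p v) (w p v')) : ℕ) : ℤ) := by
      rw [← hsum]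
      push_cast
      rw [← Finset.sum_add_distrib, Finset.mul_sum]
      exact Finset.sum_congr rfl fun p _ => by ring
    have h4 : ((∑ p ∈ S, (2 * e p + agreement (w p v) (w p v')) : ℕ) : ℤ)
      ≤ ((v ⬝ᵥ M *ᵥ v').natDegree : ℤ) := by exact_mod_cast h1
    linarith

/-! ### Families of conics: bounds for the number of sections. -/

/-- A family of plane conics `n u² + u (k z + l w) + a z² + b z w + c w²` whose coefficients are
polynomials in a parameter. -/
structure ConicFamily where
  (n k l a b c : ℂ[X])
  hn : n.natDegree ≤ 4
  hk : k.natDegree ≤ 3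
  hl : l.natDegree ≤ 3
  ha : a.natDegree ≤ 2
  hb : b.natDegree ≤ 2
  hc : c.natDegree ≤ 2

namespace ConicFamily

variable (Q : ConicFamily)

noncomputable def disc : ℂ[X] :=
  4 * Q.n * Q.a * Q.c + Q.k * Q.l * Q.b - Q.a * Q.l ^ 2 - Q.c * Q.k ^ 2 - Q.n * Q.b ^ 2

noncomputable def gram : Matrix (Fin 3) (Fin 3) ℂ[X] :=
  !![2 * Q.n, Q.k, Q.l; Q.k, 2 * Q.a, Q.b; Q.l, Q.b, 2 * Q.c]

/-- No conic of the family is the whole plane. -/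
def Nonvanishing : Prop := ∀ t, ¬ (Q.n.eval t = 0 ∧ Q.k.eval t = 0 ∧ Q.l.eval t = 0 ∧
  Q.a.eval t = 0 ∧ Q.b.eval t = 0 ∧ Q.c.eval t = 0)

/-- The sections `(1 : Z : W)` of the family with `Z` and `W` linear. -/
def sections : Set (ℂ[X] × ℂ[X]) :=
  {s | s.1.natDegree ≤ 1 ∧ s.2.natDegree ≤ 1 ∧
    Q.n + Q.k * s.1 + Q.l * s.2 + Q.a * s.1 ^ 2 + Q.b * s.1 * s.2 + Q.c * s.2 ^ 2 = 0}

/-- The constant points `(0 : z : w)` contained in all conics of the family. -/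
def basePoints : Set (ℂ × ℂ) :=
  {t | t ≠ 0 ∧ Q.a * C t.1 ^ 2 + Q.b * C t.1 * C t.2 + Q.c * C t.2 ^ 2 = 0}

theorem gram_transpose : Q.gramᵀ = Q.gram := by
  ext1 i j
  fin_cases i <;> fin_cases j <;> rfl

theorem det_gram : Q.gram.det = C 2 * Q.disc := by
  rw [det_fin_three, show (C 2 : ℂ[X]) = 2 from rfl]
  simp only [gram, disc, of_apply, cons_val]
  ring

theorem gram_form (v v' : Fin 3 → ℂ[X]) : v ⬝ᵥ Q.gram *ᵥ v' =
    2 * Q.n * (v 0 * v' 0) + Q.k * (v 0 * v' 1 + v 1 * v' 0) + Q.l * (v 0 * v' 2 + v 2 * v' 0)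
      + 2 * Q.a * (v 1 * v' 1) + Q.b * (v 1 * v' 2 + v 2 * v' 1) + 2 * Q.c * (v 2 * v' 2) := by
  simp only [dotProduct, mulVec, Fin.sum_univ_three, gram, of_apply, cons_val]
  ring

theorem gram_map_ne_zero (h : Q.Nonvanishing) (p : ℂ) : Q.gram.map (eval p) ≠ 0 := by
  intro h0
  have e : ∀ i j, (Q.gram i j).eval p = 0 := fun i j => congrFun (congrFun h0 i) j
  have e1 := e 0 0
  have e2 := e 0 1
  have e3 := e 0 2
  have e4 := e 1 1
  have e5 := e 1 2
  have e6 := e 2 2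
  simp [gram] at e1 e2 e3 e4 e5 e6
  exact h p ⟨e1, e2, e3, e4, e5, e6⟩

/-- The isotropic vector of a section. -/
noncomputable def sectionVec (s : ℂ[X] × ℂ[X]) : Fin 3 → ℂ[X] := ![1, s.1, s.2]

/-- The isotropic vector of a base point. -/
noncomputable def baseVec (t : ℂ × ℂ) : Fin 3 → ℂ[X] := ![0, C t.1, C t.2]

theorem sectionVec_isotropic {s : ℂ[X] × ℂ[X]} (hs : s ∈ Q.sections) :
    IsIsotropicPrimitive Q.gram (sectionVec s) := by
  refine fun p => ⟨?_, 0, by simp [sectionVec]⟩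
  rw [gram_form]
  simp only [sectionVec, cons_val]
  linear_combination 2 * hs.2.2

theorem baseVec_isotropic {t : ℂ × ℂ} (ht : t ∈ Q.basePoints) :
    IsIsotropicPrimitive Q.gram (baseVec t) := by
  refine fun p => ⟨?_, ?_⟩
  · rw [gram_form]
    simp only [baseVec, cons_val]
    linear_combination 2 * ht.2
  · by_contra! hc
    apply ht.1
    have h1 := hc 1
    have h2 := hc 2
    simp [baseVec] at h1 h2
    exact Prod.ext h1 h2

theorem natDegree_mul_le_of_add_le {f g : ℂ[X]} {i j d : ℕ} (hf : f.natDegree ≤ i)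
    (hg : g.natDegree ≤ j) (h : i + j ≤ d) : (f * g).natDegree ≤ d :=
  (natDegree_mul_le_of_le hf hg).trans h

/-- The disjunctions discard the terms killed by a zero first entry. With entries of degree 1 for
sections and 0 for base points, the resulting bounds are 4, 3 and 2. -/
theorem natDegree_gram_form {v v' : Fin 3 → ℂ[X]} {i i' d : ℕ}
    (h0 : (v 0).natDegree ≤ 0) (h0' : (v' 0).natDegree ≤ 0)
    (hn : v 0 * v' 0 = 0 ∨ 4 ≤ d) (hi : (v 1).natDegree ≤ i) (hj : (v 2).natDegree ≤ i)
    (hi' : (v' 1).natDegree ≤ i') (hj' : (v' 2).natDegree ≤ i')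
    (h1 : v 0 = 0 ∨ 3 + i' ≤ d) (h2 : v' 0 = 0 ∨ 3 + i ≤ d) (h3 : 2 + i + i' ≤ d) :
    (v ⬝ᵥ Q.gram *ᵥ v').natDegree ≤ d := by
  have key : ∀ {f g : ℂ[X]} {e i i' : ℕ}, (f = 0 ∨ g = 0 ∨ e + i + i' ≤ d) → f.natDegree ≤ i →
      g.natDegree ≤ i' → ∀ {q : ℂ[X]}, q.natDegree ≤ e → (q * (f * g)).natDegree ≤ d := by
    intro f g e i i' h hf hg q hq
    rcases h with rfl | rfl | h
    · simp
    · simp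
    · exact natDegree_mul_le_of_add_le hq (natDegree_mul_le_of_add_le hf hg le_rfl) (by omega)
  have two : ∀ {q : ℂ[X]} {e : ℕ}, q.natDegree ≤ e → (2 * q).natDegree ≤ e := by
    intro q e hq
    rw [← C_ofNat]
    exact (natDegree_C_mul_le _ _).trans hq
  rw [gram_form, mul_add, mul_add, mul_add]
  have a1 : v 0 = 0 ∨ v' 0 = 0 ∨ 4 + 0 + 0 ≤ d := by
    rcases hn with h | h
    · rcases mul_eq_zero.mp h with h | h
      · exact Or.inl h
      · exact Or.inr (Or.inl h)
    · exact Or.inr (Or.inr h)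
  have a2 : ∀ f : ℂ[X], v 0 = 0 ∨ f = 0 ∨ 3 + 0 + i' ≤ d := fun f => h1.imp_right Or.inr
  have a3 : ∀ f : ℂ[X], f = 0 ∨ v' 0 = 0 ∨ 3 + i + 0 ≤ d := fun f => Or.inr h2
  have a4 : ∀ f g : ℂ[X], f = 0 ∨ g = 0 ∨ 2 + i + i' ≤ d := fun f g => Or.inr (Or.inr h3)
  refine natDegree_add_le_of_degree_le (natDegree_add_le_of_degree_le
    (natDegree_add_le_of_degree_le (natDegree_add_le_of_degree_le
    (natDegree_add_le_of_degree_le ?_ (natDegree_add_le_of_degree_le ?_ ?_))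
    (natDegree_add_le_of_degree_le ?_ ?_)) ?_) (natDegree_add_le_of_degree_le ?_ ?_)) ?_
  · exact key a1 h0 h0' (two Q.hn)
  · exact key (a2 (v' 1)) h0 hi' Q.hk
  · exact key (a3 (v 1)) hi h0' Q.hk
  · exact key (a2 (v' 2)) h0 hj' Q.hl
  · exact key (a3 (v 2)) hj h0' Q.hl
  · exact key (a4 _ _) hi hi' (two Q.ha)
  · exact key (a4 _ _) hi hj' Q.hb
  · exact key (a4 _ _) hj hi' Q.hb
  · exact key (a4 _ _) hj hj' (two Q.hc)

theorem natDegree_section_section {s s' : ℂ[X] × ℂ[X]} (hs : s ∈ Q.sections)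
    (hs' : s' ∈ Q.sections) : (sectionVec s ⬝ᵥ Q.gram *ᵥ sectionVec s').natDegree ≤ 4 :=
  Q.natDegree_gram_form (by simp [sectionVec]) (by simp [sectionVec]) (Or.inr le_rfl)
    hs.1 hs.2.1 hs'.1 hs'.2.1 (Or.inr le_rfl) (Or.inr le_rfl) le_rfl

theorem natDegree_section_base {t : ℂ × ℂ} {s : ℂ[X] × ℂ[X]} (hs : s ∈ Q.sections) :
    (sectionVec s ⬝ᵥ Q.gram *ᵥ baseVec t).natDegree ≤ 3 :=
  Q.natDegree_gram_form (by simp [sectionVec]) (by simp [baseVec]) (Or.inl (by simp [baseVec]))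
    hs.1 hs.2.1 (natDegree_C _).le (natDegree_C _).le (Or.inr le_rfl) (Or.inl rfl) le_rfl

theorem natDegree_base_base (t t' : ℂ × ℂ) :
    (baseVec t ⬝ᵥ Q.gram *ᵥ baseVec t').natDegree ≤ 2 :=
  Q.natDegree_gram_form (by simp [baseVec]) (by simp [baseVec]) (Or.inl (by simp [baseVec]))
    (natDegree_C _).le (natDegree_C _).le (natDegree_C _).le (natDegree_C _).le (Or.inl rfl)
    (Or.inl rfl) le_rfl

/-- Independent isotropic vectors that are orthogonal span a totally isotropic plane, which a
nondegenerate ternary form does not have: the Gram matrix of v, v', r would have a zero 2 × 2 block,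
so det(v, v', r) = 0 for every r. -/
theorem bilin_ne_zero {M : Matrix (Fin 3) (Fin 3) ℂ[X]} (hM : Mᵀ = M) (hd : M.det ≠ 0)
    {v v' : Fin 3 → ℂ[X]} (hv : v ⬝ᵥ M *ᵥ v = 0) (hv' : v' ⬝ᵥ M *ᵥ v' = 0)
    (hc : crossProduct v v' ≠ 0) : v ⬝ᵥ M *ᵥ v' ≠ 0 := by
  intro h
  apply hc
  have hr : ∀ r : Fin 3 → ℂ[X], (Matrix.of ![v, v', r]).det = 0 := by
    intro r
    have h1 : ((Matrix.of ![v, v', r]) * M * (Matrix.of ![v, v', r])ᵀ).det = 0 := by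
      have e : ∀ i j, ((Matrix.of ![v, v', r]) * M * (Matrix.of ![v, v', r])ᵀ) i j
          = (![v, v', r] i) ⬝ᵥ M *ᵥ (![v, v', r] j) := fun i j => by
        rw [Matrix.mul_mul_apply]; rfl
      rw [det_fin_three]
      simp only [e, cons_val, hv, hv', h, (bilin_comm hM v' v).trans h]
      ring
    rw [det_mul, det_mul, det_transpose] at h1
    rcases mul_eq_zero.mp h1 with h2 | h2
    · exact (mul_eq_zero.mp h2).resolve_right hd
    · exact h2
  have e1 := hr ![1, 0, 0]
  have e2 := hr ![0, 1, 0]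
  have e3 := hr ![0, 0, 1]
  simp [det_fin_three] at e1 e2 e3
  funext i
  fin_cases i
  · simp [crossProduct]; linear_combination e1
  · simp [crossProduct]; linear_combination e2
  · simp [crossProduct]; linear_combination e3

variable {Q}

theorem section_section_ne_zero (hd : Q.disc ≠ 0) {s s' : ℂ[X] × ℂ[X]} (hs : s ∈ Q.sections)
    (hs' : s' ∈ Q.sections) (hne : s ≠ s') : sectionVec s ⬝ᵥ Q.gram *ᵥ sectionVec s' ≠ 0 := by
  refine bilin_ne_zero Q.gram_transpose ?_ (Q.sectionVec_isotropic hs 0).1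
    (Q.sectionVec_isotropic hs' 0).1 ?_
  · rw [det_gram]; simpa using hd
  · intro h
    apply hne
    have h1 := congrFun h 1
    have h2 := congrFun h 2
    simp [crossProduct, sectionVec] at h1 h2
    refine Prod.ext ?_ ?_
    · linear_combination -h2
    · linear_combination h1

theorem section_base_ne_zero (hd : Q.disc ≠ 0) {t : ℂ × ℂ} {s : ℂ[X] × ℂ[X]}
    (ht : t ∈ Q.basePoints) (hs : s ∈ Q.sections) :
    sectionVec s ⬝ᵥ Q.gram *ᵥ baseVec t ≠ 0 := by
  refine bilin_ne_zero Q.gram_transpose ?_ (Q.sectionVec_isotropic hs 0).1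
    (Q.baseVec_isotropic ht 0).1 ?_
  · rw [det_gram]; simpa using hd
  · intro h
    apply ht.1
    have h1 := congrFun h 1
    have h2 := congrFun h 2
    simp [crossProduct, sectionVec, baseVec] at h1 h2
    exact Prod.ext h2 h1

theorem base_base_ne_zero (hd : Q.disc ≠ 0) {t t' : ℂ × ℂ}
    (ht : t ∈ Q.basePoints) (ht' : t' ∈ Q.basePoints) (hne : t.1 * t'.2 - t.2 * t'.1 ≠ 0) :
    baseVec t ⬝ᵥ Q.gram *ᵥ baseVec t' ≠ 0 := by
  refine bilin_ne_zero Q.gram_transpose ?_ (Q.baseVec_isotropic ht 0).1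
    (Q.baseVec_isotropic ht' 0).1 ?_
  · rw [det_gram]; simpa using hd
  · intro h
    apply hne
    have h1 := congrFun h 0
    simp only [crossProduct, baseVec, LinearMap.mk₂_apply, cons_val, ← C_mul, ← C_sub] at h1
    exact C_injective (h1.trans C_0.symm)

/-- Three sections with proportional mutual products span a conic of sections. -/
theorem infinite_sections {P : ℂ[X]} (hP : P ≠ 0) {s : Fin 3 → ℂ[X] × ℂ[X]}
    (hs : ∀ i, s i ∈ Q.sections) {x y z : ℂ} (hx : x ≠ 0) (hy : y ≠ 0) (hz : z ≠ 0)
    (hxP : sectionVec (s 1) ⬝ᵥ Q.gram *ᵥ sectionVec (s 2) = C x * P)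
    (hyP : sectionVec (s 0) ⬝ᵥ Q.gram *ᵥ sectionVec (s 2) = C y * P)
    (hzP : sectionVec (s 0) ⬝ᵥ Q.gram *ᵥ sectionVec (s 1) = C z * P) :
    Q.sections.Infinite := by
  -- A combination with weights 1 - β - μβ, β, μβ has first entry 1. For β ≠ 0 it is isotropic
  -- exactly when β D(μ) = N(μ), so almost every μ gives a section.
  set D : ℂ[X] := (1 + X) * (C z + C y * X) - C x * X with hD
  set N : ℂ[X] := C z + C y * X with hN
  have hN0 : N ≠ 0 := by
    intro h
    have := congrArg (eval 0) h
    simp [hN] at this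
    exact hz this
  have hD0 : D ≠ 0 := by
    intro h
    have := congrArg (eval 0) h
    simp [hD, hN] at this
    exact hz this
  have hfin : {μ | (D * N).IsRoot μ}.Finite := finite_setOfPred_isRoot (mul_ne_zero hD0 hN0)
  have hinf : {μ | (D * N).IsRoot μ}ᶜ.Infinite := hfin.infinite_compl
  set β : ℂ → ℂ := fun μ => N.eval μ / D.eval μ with hβ
  set f : ℂ → ℂ[X] × ℂ[X] := fun μ =>
    (C (1 - β μ - μ * β μ) * (s 0).1 + C (β μ) * (s 1).1 + C (μ * β μ) * (s 2).1,
      C (1 - β μ - μ * β μ) * (s 0).2 + C (β μ) * (s 1).2 + C (μ * β μ) * (s 2).2) with hf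
  clear_value β
  have hvec : ∀ μ, sectionVec (f μ) = C (1 - β μ - μ * β μ) • sectionVec (s 0)
      + C (β μ) • sectionVec (s 1) + C (μ * β μ) • sectionVec (s 2) := by
    intro μ
    funext i
    fin_cases i
    · simp only [sectionVec, Fin.zero_eta, cons_val, Pi.add_apply, Pi.smul_apply, smul_eq_mul,
        mul_one, ← C_add]
      rw [← C_1]; congr 1; ring
    · simp [sectionVec, hf]
    · simp [sectionVec, hf]
  have h00 : ∀ i, sectionVec (s i) ⬝ᵥ Q.gram *ᵥ sectionVec (s i) = 0 :=
    fun i => (Q.sectionVec_isotropic (hs i) 0).1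
  have symm := bilin_comm Q.gram_transpose
  have p0 : ∀ μ, sectionVec (s 0) ⬝ᵥ Q.gram *ᵥ sectionVec (f μ)
      = C (β μ * z + μ * β μ * y) * P := by
    intro μ
    rw [hvec]
    simp only [mulVec_add, mulVec_smul, dotProduct_add, dotProduct_smul, smul_eq_mul, h00, hyP, hzP]
    simp only [C_mul, C_add]; ring
  have p1 : ∀ μ, sectionVec (s 1) ⬝ᵥ Q.gram *ᵥ sectionVec (f μ)
      = C ((1 - β μ - μ * β μ) * z + μ * β μ * x) * P := by
    intro μ
    rw [hvec]
    simp only [mulVec_add, mulVec_smul, dotProduct_add, dotProduct_smul, smul_eq_mul, h00, hxP,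
      symm _ (sectionVec (s 0)), hzP]
    simp only [C_mul, C_add]; ring
  have p2 : ∀ μ, sectionVec (s 2) ⬝ᵥ Q.gram *ᵥ sectionVec (f μ)
      = C ((1 - β μ - μ * β μ) * y + β μ * x) * P := by
    intro μ
    rw [hvec]
    simp only [mulVec_add, mulVec_smul, dotProduct_add, dotProduct_smul, smul_eq_mul, h00,
      symm _ (sectionVec (s 0)), symm (sectionVec (s 2)) (sectionVec (s 1)), hxP, hyP]
    simp only [C_mul, C_add]; ring
  have hgood : ∀ μ ∈ {μ | (D * N).IsRoot μ}ᶜ, D.eval μ ≠ 0 ∧ N.eval μ ≠ 0 := by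
    intro μ hμ
    simp only [Set.mem_compl_iff, Set.mem_ofPred_eq, IsRoot.def, eval_mul, mul_eq_zero, not_or] at hμ
    exact hμ
  have hinj : Set.InjOn f {μ | (D * N).IsRoot μ}ᶜ := by
    intro μ hμ ν hν h
    have c0 := p0 μ
    have c1 := p1 μ
    have c2 := p2 μ
    rw [h, p0 ν] at c0
    rw [h, p1 ν] at c1
    rw [h, p2 ν] at c2
    have e0 := C_injective (mul_right_cancel₀ hP c0)
    have e1 := C_injective (mul_right_cancel₀ hP c1)
    have e2 := C_injective (mul_right_cancel₀ hP c2)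
    have d2 : ν * β ν - μ * β μ = 0 := by
      have : (ν * β ν - μ * β μ) * (2 * x * y) = 0 := by
        linear_combination x * e0 + y * e1 - z * e2
      exact (mul_eq_zero.mp this).resolve_right (mul_ne_zero (mul_ne_zero two_ne_zero hx) hy)
    have d1 : β ν - β μ = 0 := by
      have : (β ν - β μ) * z = 0 := by linear_combination e0 - y * d2
      exact (mul_eq_zero.mp this).resolve_right hz
    have hβμ : β μ ≠ 0 := by
      rw [hβ]
      exact div_ne_zero (hgood μ hμ).2 (hgood μ hμ).1
    apply mul_right_cancel₀ hβμ
    linear_combination ν * d1 - d2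
  refine (hinf.image hinj).mono ?_
  rintro _ ⟨μ, hμ, rfl⟩
  have hz : sectionVec (f μ) ⬝ᵥ Q.gram *ᵥ sectionVec (f μ) = 0 := by
    conv_lhs => rw [hvec]
    simp only [add_dotProduct, smul_dotProduct, smul_eq_mul]
    rw [← hvec, p0, p1, p2]
    have hDN : β μ * ((1 + μ) * (z + y * μ) - x * μ) = z + y * μ := by
      have := div_mul_cancel₀ (N.eval μ) (hgood μ hμ).1
      rw [hβ]
      simpa [hD, hN] using this
    have : (1 - β μ - μ * β μ) * (β μ * z + μ * β μ * y)
        + β μ * ((1 - β μ - μ * β μ) * z + μ * β μ * x)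
        + μ * β μ * ((1 - β μ - μ * β μ) * y + β μ * x) = 0 := by
      linear_combination (-2 * β μ) * hDN
    rw [← mul_assoc, ← mul_assoc, ← mul_assoc, ← add_mul, ← add_mul, ← C_mul, ← C_mul, ← C_mul,
      ← C_add, ← C_add, this, C_0, zero_mul]
  have deg : ∀ (g : Fin 3 → ℂ[X]) (r : Fin 3 → ℂ), (∀ i, (g i).natDegree ≤ 1) →
      (C (r 0) * g 0 + C (r 1) * g 1 + C (r 2) * g 2).natDegree ≤ 1 := fun g r hg =>
    natDegree_add_le_of_degree_le (natDegree_add_le_of_degree_le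
      ((natDegree_C_mul_le _ _).trans (hg 0)) ((natDegree_C_mul_le _ _).trans (hg 1)))
      ((natDegree_C_mul_le _ _).trans (hg 2))
  have h1 : (f μ).1.natDegree ≤ 1 :=
    deg (fun i => (s i).1) ![1 - β μ - μ * β μ, β μ, μ * β μ] fun i => (hs i).1
  have h2 : (f μ).2.natDegree ≤ 1 :=
    deg (fun i => (s i).2) ![1 - β μ - μ * β μ, β μ, μ * β μ] fun i => (hs i).2.1
  refine ⟨h1, h2, ?_⟩
  rw [gram_form] at hz
  simp only [sectionVec, cons_val] at hz
  have : (2 : ℂ[X]) ≠ 0 := by norm_num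
  apply mul_left_cancel₀ this
  linear_combination hz

theorem exists_section_vectors (hQ : Q.Nonvanishing) (hd : Q.disc.natDegree = 8) :
    ∃ (J : Type) (_ : Fintype J) (E : ℕ) (P : ℂ[X]), Fintype.card J + 2 * E = 8 ∧ P ≠ 0 ∧
      P.natDegree = E ∧ ∃ ε : (Fin 3 → ℂ[X]) → J → ℤ, (∀ v j, ε v j = 1 ∨ ε v j = -1) ∧
        ∀ v v', IsIsotropicPrimitive Q.gram v → IsIsotropicPrimitive Q.gram v' →
          v ⬝ᵥ Q.gram *ᵥ v' ≠ 0 →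
          P ∣ v ⬝ᵥ Q.gram *ᵥ v' ∧
            ε v ⬝ᵥ ε v' ≤ 2 * ((v ⬝ᵥ Q.gram *ᵥ v').natDegree : ℤ) - 8 := by
  have hd0 : Q.disc ≠ 0 := by rintro h; simp [h] at hd
  refine exists_sign_vectors Q.gram_transpose (Q.gram_map_ne_zero hQ) (d := 8) ?_ ?_
  · rw [det_gram, natDegree_C_mul (by norm_num), hd]
  · rw [det_gram]; simpa using hd0

/-- Products of sections have degree at most 4 = 8/2, so the sign vectors are pairwise non-acute in
dimension at most 8. -/
theorem card_sections_le (hQ : Q.Nonvanishing) (hd : Q.disc.natDegree = 8)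
    (hfin : Q.sections.Finite) (I : Finset (ℂ[X] × ℂ[X])) (hI : ↑I ⊆ Q.sections) :
    I.card ≤ 16 := by
  have hd0 : Q.disc ≠ 0 := by rintro h; simp [h] at hd
  obtain ⟨J, _, E, P, hJE, hP0, hPE, ε, hε, hεb⟩ := exists_section_vectors hQ hd
  -- Without signs P has degree 4, so all products of distinct sections are constant multiples of P,
  -- and three sections would produce infinitely many.
  rcases isEmpty_or_nonempty J with hJ | hJ
  · rw [Fintype.card_eq_zero] at hJE
    by_contra! hlt
    obtain ⟨s0, h0, s1, h1, s2, h2, h01, h02, h12⟩ :=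
      Finset.two_lt_card.mp (show 2 < I.card by omega)
    have hc : ∀ s ∈ I, ∀ s' ∈ I, s ≠ s' → ∃ x : ℂ, x ≠ 0 ∧
        sectionVec s ⬝ᵥ Q.gram *ᵥ sectionVec s' = C x * P := by
      intro s hs s' hs' hne
      have hb := section_section_ne_zero hd0 (hI hs) (hI hs') hne
      obtain ⟨g, hg⟩ := (hεb _ _ (Q.sectionVec_isotropic (hI hs)) (Q.sectionVec_isotropic (hI hs'))
        hb).1
      have hdeg := Q.natDegree_section_section (hI hs) (hI hs')
      have hg0 : g ≠ 0 := by rintro rfl; simp [hg] at hb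
      rw [hg, natDegree_mul hP0 hg0] at hdeg
      obtain ⟨x, hx⟩ := natDegree_eq_zero.mp (show g.natDegree = 0 by omega)
      refine ⟨x, ?_, by rw [hg, ← hx, mul_comm]⟩
      rintro rfl
      exact hg0 (by rw [← hx, C_0])
    obtain ⟨z, hz, hzP⟩ := hc s0 h0 s1 h1 h01
    obtain ⟨y, hy, hyP⟩ := hc s0 h0 s2 h2 h02
    obtain ⟨x, hx, hxP⟩ := hc s1 h1 s2 h2 h12
    refine infinite_sections hP0 (s := ![s0, s1, s2]) ?_ hx hy hz hxP hyP hzP hfin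
    intro i
    fin_cases i
    · exact hI h0
    · exact hI h1
    · exact hI h2
  · have := card_le_two_mul_of_nonacute (fun s : I => ε (sectionVec s)) (fun s j => hε _ j) ?_
    · rw [Fintype.card_coe] at this
      omega
    · intro s s' hne
      have := (hεb _ _ (Q.sectionVec_isotropic (hI s.2)) (Q.sectionVec_isotropic (hI s'.2))
        (section_section_ne_zero hd0 (hI s.2) (hI s'.2) fun h => hne (Subtype.ext h))).2
      have := Q.natDegree_section_section (hI s.2) (hI s'.2)
      omega

/-- The product of a section and a base point has degree at most 3, so the sign vector of the base
point has a negative scalar product with that of every section. -/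
theorem card_sections_le_of_basePoint (hQ : Q.Nonvanishing) (hd : Q.disc.natDegree = 8)
    {t : ℂ × ℂ} (ht : t ∈ Q.basePoints) (I : Finset (ℂ[X] × ℂ[X])) (hI : ↑I ⊆ Q.sections) :
    I.card ≤ 8 := by
  have hd0 : Q.disc ≠ 0 := by rintro h; simp [h] at hd
  obtain ⟨J, _, E, P, hJE, hP0, hPE, ε, hε, hεb⟩ := exists_section_vectors hQ hd
  have := card_le_of_obtuse (fun s : I => ε (sectionVec s)) (ε (baseVec t)) ?_ ?_
  · rw [Fintype.card_coe] at this
    omega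
  · intro s
    have := (hεb _ _ (Q.sectionVec_isotropic (hI s.2)) (Q.baseVec_isotropic ht)
      (section_base_ne_zero hd0 ht (hI s.2))).2
    have := Q.natDegree_section_base (t := t) (hI s.2)
    omega
  · intro s s' hne
    have := (hεb _ _ (Q.sectionVec_isotropic (hI s.2)) (Q.sectionVec_isotropic (hI s'.2))
      (section_section_ne_zero hd0 (hI s.2) (hI s'.2) fun h => hne (Subtype.ext h))).2
    have := Q.natDegree_section_section (hI s.2) (hI s'.2)
    omega

/-- For N sections s, the vector Σ ε(s) + 2(ε(t) + ε(t')) has squared norm at most 8N - 16N + 32. -/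
theorem card_sections_le_of_two_basePoints (hQ : Q.Nonvanishing) (hd : Q.disc.natDegree = 8)
    {t t' : ℂ × ℂ} (ht : t ∈ Q.basePoints) (ht' : t' ∈ Q.basePoints)
    (hne : t.1 * t'.2 - t.2 * t'.1 ≠ 0) (I : Finset (ℂ[X] × ℂ[X])) (hI : ↑I ⊆ Q.sections) :
    I.card ≤ 4 := by
  have hd0 : Q.disc ≠ 0 := by rintro h; simp [h] at hd
  obtain ⟨J, _, E, P, hJE, hP0, hPE, ε, hε, hεb⟩ := exists_section_vectors hQ hd
  have self : ∀ v, ε v ⬝ᵥ ε v ≤ 8 := by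
    intro v
    have : ε v ⬝ᵥ ε v = Fintype.card J := by
      rw [dotProduct, Finset.sum_congr rfl fun j _ => (show ε v j * ε v j = 1 by
        rcases hε v j with h | h <;> simp [h])]
      simp
    omega
  have bst : ∀ {t}, t ∈ Q.basePoints → ∀ s ∈ I, ε (sectionVec s) ⬝ᵥ ε (baseVec t) ≤ -2 := by
    intro t ht s hs
    have := (hεb _ _ (Q.sectionVec_isotropic (hI hs)) (Q.baseVec_isotropic ht)
      (section_base_ne_zero hd0 ht (hI hs))).2
    have := Q.natDegree_section_base (t := t) (hI hs)
    omega
  have btt : ε (baseVec t) ⬝ᵥ ε (baseVec t') ≤ -4 := by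
    have := (hεb _ _ (Q.baseVec_isotropic ht) (Q.baseVec_isotropic ht')
      (base_base_ne_zero hd0 ht ht' hne)).2
    have := Q.natDegree_base_base t t'
    omega
  have bss : ∀ s ∈ I, ∀ s' ∈ I, ε (sectionVec s) ⬝ᵥ ε (sectionVec s') ≤ if s = s' then 8 else 0 := by
    intro s hs s' hs'
    split_ifs with h
    · rw [h]; exact self _
    · have := (hεb _ _ (Q.sectionVec_isotropic (hI hs)) (Q.sectionVec_isotropic (hI hs'))
        (section_section_ne_zero hd0 (hI hs) (hI hs') h)).2
      have := Q.natDegree_section_section (hI hs) (hI hs')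
      omega
  set x := ∑ s ∈ I, ε (sectionVec s) with hx
  have hxx : x ⬝ᵥ x ≤ 8 * I.card := by
    rw [hx, sum_dotProduct]
    have : ∀ s ∈ I, ε (sectionVec s) ⬝ᵥ ∑ s ∈ I, ε (sectionVec s) ≤ 8 := by
      intro s hs
      rw [dotProduct_sum]
      refine (Finset.sum_le_sum fun s' hs' => bss s hs s' hs').trans ?_
      simp [hs]
    refine (Finset.sum_le_sum this).trans ?_
    simp [mul_comm]
  have hxt : ∀ {t}, t ∈ Q.basePoints → x ⬝ᵥ ε (baseVec t) ≤ -2 * I.card := by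
    intro t ht
    rw [hx, sum_dotProduct]
    refine (Finset.sum_le_sum fun s hs => bst ht s hs).trans ?_
    simp [mul_comm]
  have hnn : 0 ≤ (x + 2 • (ε (baseVec t) + ε (baseVec t'))) ⬝ᵥ
      (x + 2 • (ε (baseVec t) + ε (baseVec t'))) := Finset.sum_nonneg fun i _ => mul_self_nonneg _
  have hexp : (x + 2 • (ε (baseVec t) + ε (baseVec t'))) ⬝ᵥ
      (x + 2 • (ε (baseVec t) + ε (baseVec t'))) = x ⬝ᵥ x + 4 * (x ⬝ᵥ ε (baseVec t))
        + 4 * (x ⬝ᵥ ε (baseVec t')) + 4 * (ε (baseVec t) ⬝ᵥ ε (baseVec t))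
        + 4 * (ε (baseVec t') ⬝ᵥ ε (baseVec t')) + 8 * (ε (baseVec t) ⬝ᵥ ε (baseVec t')) := by
    simp only [add_dotProduct, dotProduct_add, smul_dotProduct, dotProduct_smul, smul_add]
    rw [dotProduct_comm (ε (baseVec t)) x, dotProduct_comm (ε (baseVec t')) x,
      dotProduct_comm (ε (baseVec t')) (ε (baseVec t))]
    simp only [nsmul_eq_mul]
    ring
  have := self (baseVec t)
  have := self (baseVec t')
  have := hxt ht
  have := hxt ht'
  omega

/-! ### Lines through a base point. -/

theorem card_le_natDegree_of_fibers {f : ℂ[X]} (I : Finset (ℂ × ℂ))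
    (h : ∀ t, (I.filter fun r => r.1 = t).card ≤ f.rootMultiplicity t) :
    I.card ≤ f.natDegree := by
  classical
  rw [Finset.card_eq_sum_card_fiberwise (f := Prod.fst) (t := I.image Prod.fst)
    (fun x hx => Finset.mem_image_of_mem _ hx)]
  calc ∑ t ∈ I.image Prod.fst, (I.filter fun r => r.1 = t).card
      ≤ ∑ t ∈ I.image Prod.fst, f.roots.count t :=
        Finset.sum_le_sum fun t _ => by rw [count_roots]; exact h t
    _ ≤ ∑ t ∈ I.image Prod.fst ∪ f.roots.toFinset, f.roots.count t :=
        Finset.sum_le_sum_of_subset Finset.subset_union_left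
    _ = f.roots.card := Multiset.sum_count_eq_card fun t ht =>
        Finset.mem_union_right _ (Multiset.mem_toFinset.mpr ht)
    _ ≤ f.natDegree := f.card_roots'

/-- The lines `z = y u` through the point `(0 : 0 : 1)` contained in a conic of a family whose
coefficient of `w²` vanishes. -/
def rays (Q : ConicFamily) : Set (ℂ × ℂ) :=
  {r | Q.b.eval r.1 * r.2 + Q.l.eval r.1 = 0 ∧
    Q.a.eval r.1 * r.2 ^ 2 + Q.k.eval r.1 * r.2 + Q.n.eval r.1 = 0}

/-- For c = 0 the discriminant is, up to sign, the resultant of b y + l and a y² + k y + n, whose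
common roots y are the rays over t. If b(t) ≠ 0 there is at most one. If b(t) = 0 then l(t) = 0, the
discriminant vanishes twice, and at most two rays exist since the conic is not the whole plane. -/
theorem card_rays_le (hQ : Q.Nonvanishing) (hd : Q.disc.natDegree = 8) (hc : Q.c = 0)
    (I : Finset (ℂ × ℂ)) (hI : ↑I ⊆ Q.rays) : I.card ≤ 8 := by
  classical
  have hd0 : Q.disc ≠ 0 := by rintro h; simp [h] at hd
  rw [← hd]
  refine card_le_natDegree_of_fibers I fun t => ?_
  rcases Finset.eq_empty_or_nonempty (I.filter fun r => r.1 = t) with he | ⟨⟨t', y⟩, hr⟩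
  · simp [he]
  obtain ⟨hrI, rfl : t' = t⟩ := Finset.mem_filter.mp hr
  have hdisc : Q.disc = Q.k * Q.l * Q.b - Q.a * Q.l ^ 2 - Q.n * Q.b ^ 2 := by
    rw [disc, hc]; ring
  by_cases hb : Q.b.eval t' = 0
  · obtain ⟨h1, -⟩ := hI hrI
    have hl : Q.l.eval t' = 0 := by simpa [hb] using h1
    obtain ⟨β, hβ⟩ := dvd_iff_isRoot.mpr hb
    obtain ⟨μ, hμ⟩ := dvd_iff_isRoot.mpr hl
    have h2 : 2 ≤ Q.disc.rootMultiplicity t' := by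
      rw [le_rootMultiplicity_iff hd0]
      refine ⟨Q.k * μ * β - Q.a * μ ^ 2 - Q.n * β ^ 2, ?_⟩
      rw [hdisc, hβ, hμ]; ring
    refine le_trans ?_ h2
    set g : ℂ[X] := C (Q.a.eval t') * X ^ 2 + C (Q.k.eval t') * X + C (Q.n.eval t') with hg
    have hg0 : g ≠ 0 := by
      intro h
      have c0 := congrArg (coeff · 0) h
      have c1 := congrArg (coeff · 1) h
      have c2 := congrArg (coeff · 2) h
      simp [hg, coeff_X, coeff_C] at c0 c1 c2
      exact hQ t' ⟨c0, c1, hl, c2, hb, by simp [hc]⟩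
    calc (I.filter fun r => r.1 = t').card ≤ g.roots.toFinset.card := by
          refine Finset.card_le_card_of_injOn Prod.snd ?_ ?_
          · rintro ⟨s, z⟩ hs
            obtain ⟨hs1, rfl : s = t'⟩ := Finset.mem_filter.mp hs
            have := (hI hs1).2
            simp only [Finset.mem_coe, Multiset.mem_toFinset, mem_roots hg0, IsRoot.def]
            simpa [hg] using this
          · rintro ⟨s, z⟩ hs ⟨s', z'⟩ hs' h
            obtain ⟨-, rfl : s = t'⟩ := Finset.mem_filter.mp hs
            obtain ⟨-, rfl : s' = s⟩ := Finset.mem_filter.mp hs'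
            exact Prod.ext rfl h
      _ ≤ g.roots.card := Multiset.toFinset_card_le _
      _ ≤ g.natDegree := g.card_roots'
      _ ≤ 2 := natDegree_quadratic_le
  -- Eliminating y from the two ray equations shows that the discriminant vanishes.
  · have h1 : 1 ≤ Q.disc.rootMultiplicity t' := by
      rw [Nat.succ_le_iff, rootMultiplicity_pos hd0, IsRoot.def, hdisc]
      obtain ⟨h1, h2⟩ := hI hrI
      simp only [eval_sub, eval_mul, eval_pow] at h1 h2 ⊢
      linear_combination (Q.k.eval t' * Q.b.eval t' + Q.a.eval t' * (Q.b.eval t' * y)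
        - Q.a.eval t' * Q.l.eval t') * h1 - (Q.b.eval t') ^ 2 * h2
    refine le_trans (Finset.card_le_one.mpr ?_) h1
    rintro ⟨s, z⟩ hs ⟨s', z'⟩ hs'
    obtain ⟨hs1, rfl : s = t'⟩ := Finset.mem_filter.mp hs
    obtain ⟨hs1', rfl : s' = s⟩ := Finset.mem_filter.mp hs'
    refine Prod.ext rfl ?_
    have e1 := (hI hs1).1
    have e2 := (hI hs1').1
    apply mul_left_cancel₀ hb
    simp only at e1 e2 ⊢
    linear_combination e1 - e2

/-- For a = c = 0 both ray equations are linear in y and the discriminant is b(kl - nb). Rays lie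
over roots of kl - nb, of degree at most 6; two over the same t would make the whole conic vanish.
-/
theorem card_rays_le_of_two_basePoints (hQ : Q.Nonvanishing) (hd0 : Q.disc ≠ 0) (ha : Q.a = 0)
    (hc : Q.c = 0) (I : Finset (ℂ × ℂ)) (hI : ↑I ⊆ Q.rays) : I.card ≤ 6 := by
  classical
  set f := Q.k * Q.l - Q.n * Q.b with hf
  have hf0 : f ≠ 0 := by
    intro h
    apply hd0
    rw [disc, ha, hc]
    linear_combination Q.b * h
  have hdeg : f.natDegree ≤ 6 := natDegree_sub_le_of_le
    (natDegree_mul_le_of_add_le Q.hk Q.hl le_rfl) (natDegree_mul_le_of_add_le Q.hn Q.hb le_rfl)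
  refine (card_le_natDegree_of_fibers I fun t => ?_).trans hdeg
  rcases Finset.eq_empty_or_nonempty (I.filter fun r => r.1 = t) with he | ⟨⟨t', y⟩, hr⟩
  · simp [he]
  obtain ⟨hrI, rfl : t' = t⟩ := Finset.mem_filter.mp hr
  have h1 : 1 ≤ f.rootMultiplicity t' := by
    rw [Nat.succ_le_iff, rootMultiplicity_pos hf0, IsRoot.def]
    obtain ⟨h1, h2⟩ := hI hrI
    simp only [hf, ha, eval_sub, eval_mul, eval_zero] at h1 h2 ⊢
    linear_combination Q.k.eval t' * h1 - Q.b.eval t' * h2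
  refine le_trans (Finset.card_le_one.mpr ?_) h1
  rintro ⟨s, z⟩ hs ⟨s', z'⟩ hs'
  obtain ⟨hs1, rfl : s = t'⟩ := Finset.mem_filter.mp hs
  obtain ⟨hs1', rfl : s' = s⟩ := Finset.mem_filter.mp hs'
  refine Prod.ext rfl ?_
  obtain ⟨e1, e2⟩ := hI hs1
  obtain ⟨e1', e2'⟩ := hI hs1'
  simp only [ha, eval_zero, zero_mul, zero_add] at e1 e2 e1' e2' ⊢
  by_contra hne
  have hb : Q.b.eval s' = 0 := by
    have : Q.b.eval s' * (z - z') = 0 := by linear_combination e1 - e1'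
    exact (mul_eq_zero.mp this).resolve_right (sub_ne_zero.mpr hne)
  have hk : Q.k.eval s' = 0 := by
    have : Q.k.eval s' * (z - z') = 0 := by linear_combination e2 - e2'
    exact (mul_eq_zero.mp this).resolve_right (sub_ne_zero.mpr hne)
  rw [hb] at e1
  rw [hk] at e2
  exact hQ s' ⟨by simpa using e2, hk, by simpa using e1, by simp [ha], hb, by simp [hc]⟩

end ConicFamily

/-! ### The equation of the surface in coordinates adapted to the double line. -/

/-- The restriction of `F` to the planes `y = t x` is `x²` times the conics of `Q`, where
`x, y, z, w` are the coordinates with respect to `e`; likewise for the plane `x = 0`, at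
`t = ∞`. -/
structure Represents (F : MvPolynomial (Fin 4) ℂ) (e : Fin 4 → Fin 4 → ℂ) (Q : ConicFamily) :
    Prop where
  affine : ∀ x t z w : ℂ, MvPolynomial.eval (x • e 0 + (t * x) • e 1 + z • e 2 + w • e 3) F
    = x ^ 2 * (Q.n.eval t * x ^ 2 + x * (Q.k.eval t * z + Q.l.eval t * w)
      + Q.a.eval t * z ^ 2 + Q.b.eval t * z * w + Q.c.eval t * w ^ 2)
  infinite : ∀ y z w : ℂ, MvPolynomial.eval (y • e 1 + z • e 2 + w • e 3) F
    = y ^ 2 * (Q.n.coeff 4 * y ^ 2 + y * (Q.k.coeff 3 * z + Q.l.coeff 3 * w)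
      + Q.a.coeff 2 * z ^ 2 + Q.b.coeff 2 * z * w + Q.c.coeff 2 * w ^ 2)

theorem derivative_aeval_eq {σ : Type*} [Fintype σ] (g : σ → ℂ[X]) (F : MvPolynomial σ ℂ) :
    derivative (MvPolynomial.aeval g F)
      = ∑ i, MvPolynomial.aeval g (MvPolynomial.pderiv i F) * derivative (g i) := by
  classical
  induction F using MvPolynomial.induction_on with
  | C a => simp
  | add p q hp hq => simp [hp, hq, Finset.sum_add_distrib, add_mul]
  | mul_X p j hp =>
    rw [map_mul, derivative_mul, hp]
    simp only [MvPolynomial.aeval_X, Derivation.leibniz, MvPolynomial.pderiv_X, smul_eq_mul,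
      map_add, map_mul, add_mul, Finset.sum_add_distrib]
    rw [add_comm]
    congr 1
    · rw [Finset.sum_eq_single j]
      · simp
      · intro b _ hb; simp [Pi.single_eq_of_ne hb.symm]
      · simp
    · rw [Finset.sum_mul]
      exact Finset.sum_congr rfl fun i _ => by ring

/-- Along a line through a singular point, the polynomial vanishes to order two. -/
theorem exists_eval_eq_sq_mul {F : MvPolynomial (Fin 4) ℂ} {v : Fin 4 → ℂ}
    (h0 : MvPolynomial.eval v F = 0)
    (h1 : ∀ i, MvPolynomial.eval v (MvPolynomial.pderiv i F) = 0) (u : Fin 4 → ℂ) :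
    ∃ g : ℂ[X], ∀ ε : ℂ, MvPolynomial.eval (ε • u + v) F = ε ^ 2 * g.eval ε := by
  set q : Fin 4 → ℂ[X] := fun i => C (v i) + C (u i) * X with hq
  have hev : ∀ (G : MvPolynomial (Fin 4) ℂ) (ε : ℂ),
      (MvPolynomial.aeval q G).eval ε = MvPolynomial.eval (ε • u + v) G := by
    intro G ε
    induction G using MvPolynomial.induction_on with
    | C a => simp
    | add p q hp hq => simp [hp, hq]
    | mul_X p j hp =>
      simp only [map_mul, eval_mul, hp, MvPolynomial.aeval_X, MvPolynomial.eval_X]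
      simp [hq]; ring_nf; simp
  have hdvd : X ^ 2 ∣ MvPolynomial.aeval q F := by
    rw [X_pow_dvd_iff]
    intro d hd
    interval_cases d
    · rw [coeff_zero_eq_eval_zero, hev]; simpa using h0
    · have := coeff_derivative (MvPolynomial.aeval q F) 0
      rw [derivative_aeval_eq, coeff_zero_eq_eval_zero, eval_finsetSum] at this
      simp only [eval_mul, hev, zero_smul, zero_add, h1, zero_mul, Finset.sum_const_zero] at this
      simpa using this.symm
  obtain ⟨g, hg⟩ := hdvd
  exact ⟨g, fun ε => by rw [← hev, hg]; simp⟩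

/-- The coefficients of a homogeneous polynomial of degree four. -/
theorem exists_quartic_coeffs {G : MvPolynomial (Fin 4) ℂ} (hG : G.IsHomogeneous 4) :
    ∃ c : ℕ → ℕ → ℕ → ℂ, ∀ x y z w : ℂ, MvPolynomial.eval ![x, y, z, w] G =
      ∑ i ∈ Finset.range 5, ∑ j ∈ Finset.range (5 - i), ∑ k ∈ Finset.range (5 - i - j),
        c i j k * x ^ i * y ^ j * z ^ k * w ^ (4 - i - j - k) := by
  classical
  set m : ℕ → ℕ → ℕ → (Fin 4 →₀ ℕ) := fun i j k =>
    Finsupp.equivFunOnFinite.symm ![i, j, k, 4 - i - j - k] with hm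
  refine ⟨fun i j k => MvPolynomial.coeff (m i j k) G, fun x y z w => ?_⟩
  simp only [Finset.sum_sigma']
  rw [MvPolynomial.eval_eq']
  symm
  set T := (Finset.range 5).sigma fun i => (Finset.range (5 - i)).sigma fun j =>
    Finset.range (5 - i - j)
  have hsub : G.support ⊆ T.image fun r => m r.1 r.2.1 r.2.2 := by
    intro d hd
    have hdeg := hG (MvPolynomial.mem_support_iff.mp hd)
    rw [Finsupp.weight_apply, Finsupp.sum_fintype _ _ (by simp)] at hdeg
    simp [Fin.sum_univ_four] at hdeg
    rw [Finset.mem_image]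
    refine ⟨⟨d 0, d 1, d 2⟩, ?_, ?_⟩
    · simp only [T, Finset.mem_sigma, Finset.mem_range]
      omega
    · ext i
      fin_cases i
      · simp [hm]
      · simp [hm]
      · simp [hm]
      · simp [hm]; omega
  rw [Finset.sum_subset hsub, Finset.sum_image]
  · refine Finset.sum_congr rfl fun r _ => ?_
    simp [Fin.prod_univ_four, hm, mul_assoc]
  · rintro ⟨i, j, k⟩ hr ⟨i', j', k'⟩ hr' h
    have h0 := DFunLike.congr_fun h 0
    have h1 := DFunLike.congr_fun h 1
    have h2 := DFunLike.congr_fun h 2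
    simp [hm] at h0 h1 h2
    subst h0 h1 h2
    rfl
  · intro d _ hd
    rw [MvPolynomial.notMem_support_iff.mp hd, zero_mul]

theorem coeffs_eq_zero_of_eval {d : ℕ} {p : ℕ → ℂ}
    (h : ∀ z : ℂ, ∑ k ∈ Finset.range d, p k * z ^ k = 0) : ∀ k < d, p k = 0 := by
  have h1 : ∑ k ∈ Finset.range d, C (p k) * X ^ k = (0 : ℂ[X]) := by
    apply Polynomial.funext
    intro z
    simpa [eval_finsetSum] using h z
  intro k hk
  have h2 := congrArg (coeff · k) h1
  simpa [finsetSum_coeff, coeff_C_mul, coeff_X_pow, hk] using h2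

theorem eval_aeval_eq {σ τ : Type*} (L : σ → MvPolynomial τ ℂ) (F : MvPolynomial σ ℂ) (v : τ → ℂ) :
    MvPolynomial.eval v (MvPolynomial.aeval L F)
      = MvPolynomial.eval (fun i => MvPolynomial.eval v (L i)) F := by
  induction F using MvPolynomial.induction_on with
  | C a => simp
  | add p q hp hq => rw [map_add, map_add, map_add, hp, hq]
  | mul_X p j hp => rw [map_mul, map_mul, map_mul, hp, MvPolynomial.aeval_X, MvPolynomial.eval_X]

/-- Singularity along ℓ removes the monomials of degree at most 1 in x and y. Grouping the others by
their z, w part gives the six coefficients; the exponent of t is that of y, so the top coefficients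
describe the plane x = 0. -/
theorem exists_represents {F : MvPolynomial (Fin 4) ℂ} (hF : F.IsHomogeneous 4)
    (e : Fin 4 → Fin 4 → ℂ)
    (hs : ∀ z w : ℂ, MvPolynomial.eval (z • e 2 + w • e 3) F = 0 ∧
      ∀ i, MvPolynomial.eval (z • e 2 + w • e 3) (MvPolynomial.pderiv i F) = 0) :
    ∃ Q, Represents F e Q := by
  set L : Fin 4 → MvPolynomial (Fin 4) ℂ := fun i =>
    ∑ j, MvPolynomial.C (e j i) * MvPolynomial.X j with hL
  have hLh : ∀ i, (L i).IsHomogeneous 1 := fun i =>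
    MvPolynomial.IsHomogeneous.sum _ _ _ fun j _ =>
      (MvPolynomial.isHomogeneous_C_mul_X (e j i) j)
  have hG : (MvPolynomial.aeval L F).IsHomogeneous 4 := by
    simpa using hF.aeval L hLh
  have hGe : ∀ x y z w : ℂ, MvPolynomial.eval ![x, y, z, w] (MvPolynomial.aeval L F)
      = MvPolynomial.eval (x • e 0 + y • e 1 + z • e 2 + w • e 3) F := by
    intro x y z w
    rw [eval_aeval_eq]
    congr 1
    congr 1
    funext i
    simp [hL, Fin.sum_univ_four, mul_comm]
  obtain ⟨c, hc⟩ := exists_quartic_coeffs hG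
  have main := fun x y z w => (hGe x y z w).symm.trans (hc x y z w)
  have c00 : ∀ k < 5, c 0 0 k = 0 := by
    apply coeffs_eq_zero_of_eval
    intro z
    have h1 := main 0 0 z 1
    rw [zero_smul, zero_smul, zero_add, zero_add, (hs z 1).1] at h1
    simp [Finset.sum_range_succ] at h1
    simp [Finset.sum_range_succ, h1]
  -- On the line leaving a point of ℓ (with w = 1) in the direction e i, F vanishes to order two, so
  -- its linear coefficient is zero.
  have lin : ∀ (i : Fin 4) (z : ℂ) (p : ℕ → ℂ), p 0 = 0 → (∀ ε : ℂ,
      MvPolynomial.eval (ε • e i + (z • e 2 + (1 : ℂ) • e 3)) F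
        = ∑ j ∈ Finset.range 5, p j * ε ^ j) → p 1 = 0 := by
    intro i z p hp h
    obtain ⟨g, hg⟩ := exists_eval_eq_sq_mul (hs z 1).1 (hs z 1).2 (e i)
    have h1 : ∑ j ∈ Finset.range 5, C (p j) * X ^ j = X ^ 2 * g := by
      apply Polynomial.funext
      intro ε
      have := (h ε).symm.trans (hg ε)
      simpa [eval_finsetSum] using this
    have h2 := congrArg (coeff · 1) h1
    simpa [finsetSum_coeff, coeff_C_mul, coeff_X_pow, coeff_X_pow_mul'] using h2
  have c10 : ∀ k < 4, c 1 0 k = 0 := by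
    apply coeffs_eq_zero_of_eval
    intro z
    refine lin 0 z (fun i => ∑ k ∈ Finset.range (5 - i), c i 0 k * z ^ k) ?_ ?_
    · exact Finset.sum_eq_zero fun k hk => by rw [c00 k (Finset.mem_range.mp hk), zero_mul]
    · intro ε
      have h1 := main ε 0 z 1
      rw [zero_smul, add_zero, add_assoc] at h1
      rw [h1]
      simp [Finset.sum_range_succ]
      ring
  have c01 : ∀ k < 4, c 0 1 k = 0 := by
    apply coeffs_eq_zero_of_eval
    intro z
    refine lin 1 z (fun j => ∑ k ∈ Finset.range (5 - j), c 0 j k * z ^ k) ?_ ?_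
    · exact Finset.sum_eq_zero fun k hk => by rw [c00 k (Finset.mem_range.mp hk), zero_mul]
    · intro ε
      have h1 := main 0 ε z 1
      rw [zero_smul, zero_add, add_assoc] at h1
      rw [h1]
      simp [Finset.sum_range_succ]
      ring
  have deg : ∀ (d : ℕ) (f : ℕ → ℂ), (∑ j ∈ Finset.range (d + 1), C (f j) * X ^ j).natDegree ≤ d := by
    intro d f
    refine natDegree_sum_le_of_forall_le _ _ fun j hj => ?_
    exact (natDegree_C_mul_X_pow_le _ _).trans (Nat.lt_succ_iff.mp (Finset.mem_range.mp hj))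
  refine ⟨⟨∑ j ∈ Finset.range 5, C (c (4 - j) j 0) * X ^ j,
    ∑ j ∈ Finset.range 4, C (c (3 - j) j 1) * X ^ j,
    ∑ j ∈ Finset.range 4, C (c (3 - j) j 0) * X ^ j,
    ∑ j ∈ Finset.range 3, C (c (2 - j) j 2) * X ^ j,
    ∑ j ∈ Finset.range 3, C (c (2 - j) j 1) * X ^ j,
    ∑ j ∈ Finset.range 3, C (c (2 - j) j 0) * X ^ j,
    deg 4 _, deg 3 _, deg 3 _, deg 2 _, deg 2 _, deg 2 _⟩, ?_, ?_⟩
  · intro x t z w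
    rw [main]
    simp [Finset.sum_range_succ, c00, c10, c01]
    ring
  · intro y z w
    have h1 := main 0 y z w
    rw [zero_smul, zero_add] at h1
    rw [h1]
    simp [Finset.sum_range_succ, c00, c01, coeff_X_pow]
    ring

/-- Continuity recovers the points lost when an identity is divided by a coordinate. -/
theorem eval_eq_of_forall_ne {F : MvPolynomial (Fin 4) ℂ} {u v : Fin 4 → ℂ} {g : ℂ → ℂ}
    (hg : Continuous g) (h : ∀ x : ℂ, x ≠ 0 → MvPolynomial.eval (x • u + v) F = g x) :
    MvPolynomial.eval v F = g 0 := by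
  have h1 : Continuous fun x : ℂ => MvPolynomial.eval (x • u + v) F :=
    (MvPolynomial.continuous_eval F).comp (by fun_prop)
  have h2 := h1.ext_on (dense_compl_singleton 0) hg (fun x hx => h x hx)
  simpa using congrFun h2 0

/-! ### Lines and bases in ℂ⁴. -/

theorem isProjLine_span_pair {u v : Fin 4 → ℂ} (h : LinearIndependent ℂ ![u, v]) :
    IsProjLine (Submodule.span ℂ {u, v}) := by
  have := finrank_span_eq_card h
  rwa [Matrix.range_cons_cons_empty, Fintype.card_fin] at this

theorem span_pair_eq_of_isProjLine {L : Submodule ℂ (Fin 4 → ℂ)} (hL : IsProjLine L)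
    {u v : Fin 4 → ℂ} (hu : u ∈ L) (hv : v ∈ L) (h : LinearIndependent ℂ ![u, v]) :
    Submodule.span ℂ {u, v} = L := by
  refine Submodule.eq_of_le_of_finrank_eq ?_ ((isProjLine_span_pair h).trans hL.symm)
  rw [Submodule.span_le]
  rintro x (rfl | rfl) <;> assumption

theorem linearIndependent_pair_of_repr (e : Module.Basis (Fin 4) ℂ (Fin 4 → ℂ))
    {u v : Fin 4 → ℂ} {i j : Fin 4} (h : e.repr u i * e.repr v j - e.repr u j * e.repr v i ≠ 0) :
    LinearIndependent ℂ ![u, v] := by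
  rw [LinearIndependent.pair_iff]
  intro s t hst
  have h1 := congrArg (fun x => e.repr x i) hst
  have h2 := congrArg (fun x => e.repr x j) hst
  simp at h1 h2
  constructor
  · have : s * (e.repr u i * e.repr v j - e.repr u j * e.repr v i) = 0 := by
      linear_combination e.repr v j * h1 - e.repr v i * h2
    exact (mul_eq_zero.mp this).resolve_right h
  · have : t * (e.repr u i * e.repr v j - e.repr u j * e.repr v i) = 0 := by
      linear_combination e.repr u i * h2 - e.repr u j * h1
    exact (mul_eq_zero.mp this).resolve_right h

theorem exists_basis_of_isProjLine {ℓ : Submodule ℂ (Fin 4 → ℂ)} (hℓ : IsProjLine ℓ) :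
    ∃ e : Module.Basis (Fin 4) ℂ (Fin 4 → ℂ), ℓ = Submodule.span ℂ {e 2, e 3} := by
  obtain ⟨K, hK⟩ := Submodule.exists_isCompl ℓ
  have hKr : Module.finrank ℂ K = 2 := by
    have := Submodule.finrank_add_eq_of_isCompl hK
    rw [hℓ] at this
    simp at this
    omega
  set b₁ := Module.finBasisOfFinrankEq ℂ K hKr
  set b₂ := Module.finBasisOfFinrankEq ℂ ℓ hℓ
  set e := ((b₁.prod b₂).map (Submodule.prodEquivOfIsCompl K ℓ hK.symm)).reindex
    (finSumFinEquiv (m := 2) (n := 2))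
  have h2 : e 2 = b₂ 0 := by
    have : (finSumFinEquiv (m := 2) (n := 2)).symm 2 = Sum.inr 0 := rfl
    simp [e, this]
  have h3 : e 3 = b₂ 1 := by
    have : (finSumFinEquiv (m := 2) (n := 2)).symm 3 = Sum.inr 1 := rfl
    simp [e, this]
  refine ⟨e, (span_pair_eq_of_isProjLine hℓ ?_ ?_ ?_).symm⟩
  · rw [h2]; exact (b₂ 0).2
  · rw [h3]; exact (b₂ 1).2
  · exact linearIndependent_pair_of_repr e (i := 2) (j := 3) (by simp)

/-! ### The pencil of planes, the discriminant, and lines as sections or rays. -/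

section Coordinates

variable {F : MvPolynomial (Fin 4) ℂ} {e : Module.Basis (Fin 4) ℂ (Fin 4 → ℂ)}
  {Q : ConicFamily}

theorem Module.Basis.eq_combination (e : Module.Basis (Fin 4) ℂ (Fin 4 → ℂ)) (v : Fin 4 → ℂ) :
    v = e.repr v 0 • e 0 + e.repr v 1 • e 1 + e.repr v 2 • e 2 + e.repr v 3 • e 3 := by
  conv_lhs => rw [← e.sum_repr v]
  rw [Fin.sum_univ_four]

theorem Module.Basis.repr_combination (e : Module.Basis (Fin 4) ℂ (Fin 4 → ℂ)) (x y z w : ℂ) :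
    e.repr (x • e 0 + y • e 1 + z • e 2 + w • e 3) 0 = x ∧
    e.repr (x • e 0 + y • e 1 + z • e 2 + w • e 3) 1 = y ∧
    e.repr (x • e 0 + y • e 1 + z • e 2 + w • e 3) 2 = z ∧
    e.repr (x • e 0 + y • e 1 + z • e 2 + w • e 3) 3 = w := by
  refine ⟨?_, ?_, ?_, ?_⟩ <;> simp

theorem mem_span_iff_repr {v : Fin 4 → ℂ} :
    v ∈ Submodule.span ℂ {e 2, e 3} ↔ e.repr v 0 = 0 ∧ e.repr v 1 = 0 := by
  rw [Submodule.mem_span_pair]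
  constructor
  · rintro ⟨z, w, rfl⟩
    constructor <;> simp
  · rintro ⟨h0, h1⟩
    refine ⟨e.repr v 2, e.repr v 3, ?_⟩
    conv_rhs => rw [e.eq_combination v, h0, h1]
    simp

theorem isProjLine_span_basis (e : Module.Basis (Fin 4) ℂ (Fin 4 → ℂ)) :
    IsProjLine (Submodule.span ℂ {e 2, e 3}) :=
  isProjLine_span_pair (linearIndependent_pair_of_repr e (i := 2) (j := 3)
    (by simp))

/-- The plane `y = t x`. -/
noncomputable def pencilPlane (e : Module.Basis (Fin 4) ℂ (Fin 4 → ℂ)) (t : ℂ) :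
    Submodule ℂ (Fin 4 → ℂ) := LinearMap.ker (e.coord 1 - t • e.coord 0)

theorem mem_pencilPlane {t : ℂ} {v : Fin 4 → ℂ} :
    v ∈ pencilPlane e t ↔ e.repr v 1 = t * e.repr v 0 := by
  simp [pencilPlane, sub_eq_zero]

theorem eq_of_le_pencilPlane {L : Submodule ℂ (Fin 4 → ℂ)} (hL : IsProjLine L)
    (hne : L ≠ Submodule.span ℂ {e 2, e 3}) {t s : ℂ} (ht : L ≤ pencilPlane e t)
    (hs : L ≤ pencilPlane e s) : t = s := by
  by_contra hts
  apply hne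
  refine Submodule.eq_of_le_of_finrank_eq (fun v hv => ?_)
    (hL.trans (isProjLine_span_basis e).symm)
  have h1 := mem_pencilPlane.mp (ht hv)
  have h2 := mem_pencilPlane.mp (hs hv)
  have h3 : e.repr v 0 = 0 := by
    have : (t - s) * e.repr v 0 = 0 := by linear_combination h2 - h1
    exact (mul_eq_zero.mp this).resolve_left (sub_ne_zero.mpr hts)
  exact mem_span_iff_repr.mpr ⟨h3, by rw [h1, h3, mul_zero]⟩

/-- Two planes of the pencil meet only in ℓ, so each other line accounts for at most one parameter.
-/
theorem finite_parameters_of_lines (hfin : (linesOn F).Finite)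
    (e : Module.Basis (Fin 4) ℂ (Fin 4 → ℂ)) :
    {t | ∃ L ∈ linesOn F, L ≠ Submodule.span ℂ {e 2, e 3} ∧ L ≤ pencilPlane e t}.Finite := by
  refine (hfin.biUnion (t := fun L => {t | L ∈ linesOn F ∧ L ≠ Submodule.span ℂ {e 2, e 3} ∧
    L ≤ pencilPlane e t}) fun L _ => Set.Subsingleton.finite ?_).subset ?_
  · rintro t ⟨h1, h2, h3⟩ s ⟨-, -, h6⟩
    exact eq_of_le_pencilPlane h1.1 h2 h3 h6
  · rintro t ⟨L, h1, h2, h3⟩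
    exact Set.mem_biUnion h1 ⟨h1, h2, h3⟩

/-- A plane spanned by `e 2`, `e 3` and `u` contained in a surface gives infinitely many lines. -/
theorem infinite_linesOn_of_plane {u : Fin 4 → ℂ} (hu : e.repr u 0 ≠ 0 ∨ e.repr u 1 ≠ 0)
    (h : ∀ x z w : ℂ, MvPolynomial.eval (x • u + z • e 2 + w • e 3) F = 0) :
    (linesOn F).Infinite := by
  obtain ⟨i, hi2, hi3, hi⟩ : ∃ i : Fin 4, i ≠ 2 ∧ i ≠ 3 ∧ e.repr u i ≠ 0 := by
    rcases hu with h | h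
    · exact ⟨0, by decide, by decide, h⟩
    · exact ⟨1, by decide, by decide, h⟩
  have hinj : Function.Injective fun μ : ℂ => Submodule.span ℂ {e 2, u + μ • e 3} := by
    intro μ ν hμν
    have h1 : u + μ • e 3 ∈ Submodule.span ℂ {e 2, u + ν • e 3} := by
      rw [← show Submodule.span ℂ {e 2, u + μ • e 3} = Submodule.span ℂ {e 2, u + ν • e 3} from hμν]
      exact Submodule.subset_span (by simp)
    obtain ⟨a, b, hab⟩ := Submodule.mem_span_pair.mp h1
    have e1 := congrArg (fun x => e.repr x i) hab
    have e2 := congrArg (fun x => e.repr x 3) hab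
    simp [hi2.symm, hi3.symm] at e1 e2
    have hb : b = 1 := mul_right_cancel₀ hi (e1.trans (one_mul _).symm)
    rw [hb] at e2
    simpa using e2.symm
  refine (Set.infinite_range_of_injective hinj).mono ?_
  rintro _ ⟨μ, rfl⟩
  refine ⟨isProjLine_span_pair (linearIndependent_pair_of_repr e (i := 2) (j := i) ?_), ?_⟩
  · simp [hi2.symm, hi3.symm, hi]
  · intro v hv
    obtain ⟨a, b, rfl⟩ := Submodule.mem_span_pair.mp hv
    rw [show a • e 2 + b • (u + μ • e 3) = b • u + a • e 2 + (b * μ) • e 3 by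
      rw [smul_add, smul_smul]; abel]
    exact h _ _ _

theorem Represents.affine_point (h : Represents F e Q) (t z w x : ℂ) :
    MvPolynomial.eval (x • (e 0 + t • e 1) + z • e 2 + w • e 3) F
      = x ^ 2 * (Q.n.eval t * x ^ 2 + x * (Q.k.eval t * z + Q.l.eval t * w)
      + Q.a.eval t * z ^ 2 + Q.b.eval t * z * w + Q.c.eval t * w ^ 2) := by
  rw [← h.affine, smul_add, smul_smul, mul_comm x t]

theorem Represents.nonvanishing (h : Represents F e Q) (hfin : (linesOn F).Finite) :
    Q.Nonvanishing := by
  rintro t ⟨h1, h2, h3, h4, h5, h6⟩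
  refine infinite_linesOn_of_plane (e := e) (u := e 0 + t • e 1) ?_ ?_ hfin
  · simp
  · intro x z w
    rw [h.affine_point, h1, h2, h3, h4, h5, h6]
    ring

theorem exists_root_quadratic {α β : ℂ} (h : α ≠ 0 ∨ β ≠ 0) (γ : ℂ) :
    ∃ y : ℂ, α * y ^ 2 + β * y + γ = 0 := by
  have hdeg : (C α * X ^ 2 + C β * X + C γ : ℂ[X]).degree ≠ 0 := by
    by_cases hα : α = 0
    · rw [hα, C_0, zero_mul, zero_add, degree_linear (h.resolve_left (by simpa using hα))]
      decide
    · rw [degree_quadratic hα]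
      decide
  obtain ⟨y, hy⟩ := IsAlgClosed.exists_root _ hdeg
  exact ⟨y, by simpa using hy⟩

/-- A degenerate conic other than `u² = 0` contains a line different from `u = 0`. -/
theorem exists_line_of_disc_eq_zero {n k l a b c : ℂ}
    (hd : 4 * n * a * c + k * l * b - a * l ^ 2 - c * k ^ 2 - n * b ^ 2 = 0)
    (hne : ¬ (k = 0 ∧ l = 0 ∧ a = 0 ∧ b = 0 ∧ c = 0)) :
    ∃ z₀ w₀ z₁ w₁ : ℂ, (z₀ ≠ 0 ∨ w₀ ≠ 0) ∧ a * z₀ ^ 2 + b * z₀ * w₀ + c * w₀ ^ 2 = 0 ∧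
      n + k * z₁ + l * w₁ + a * z₁ ^ 2 + b * z₁ * w₁ + c * w₁ ^ 2 = 0 ∧
      k * z₀ + l * w₀ + 2 * a * z₀ * z₁ + b * (z₀ * w₁ + w₀ * z₁) + 2 * c * w₀ * w₁ = 0 := by
  have hdet : (!![2 * n, k, l; k, 2 * a, b; l, b, 2 * c] : Matrix (Fin 3) (Fin 3) ℂ).det = 0 := by
    rw [det_fin_three]
    simp only [of_apply, cons_val]
    linear_combination 2 * hd
  obtain ⟨v, hv, hvM⟩ := exists_mulVec_eq_zero_iff.mpr hdet
  have e0 := congrFun hvM 0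
  have e1 := congrFun hvM 1
  have e2 := congrFun hvM 2
  simp only [mulVec, dotProduct, Fin.sum_univ_three, of_apply, cons_val, Pi.zero_apply] at e0 e1 e2
  -- The kernel vector v is a vertex of the conic. If it lies on u = 0, it is joined to a point of
  -- the conic off that line, otherwise to a point of the conic on it.
  by_cases h0 : v 0 = 0
  · have hT : v 1 ≠ 0 ∨ v 2 ≠ 0 := by
      by_contra! hc
      apply hv
      funext i
      fin_cases i
      · exact h0
      · exact hc.1
      · exact hc.2
    rw [h0] at e0 e1 e2
    obtain ⟨z₁, w₁, h1⟩ : ∃ z₁ w₁ : ℂ,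
        n + k * z₁ + l * w₁ + a * z₁ ^ 2 + b * z₁ * w₁ + c * w₁ ^ 2 = 0 := by
      by_cases hka : a ≠ 0 ∨ k ≠ 0
      · obtain ⟨y, hy⟩ := exists_root_quadratic hka n
        exact ⟨y, 0, by linear_combination hy⟩
      by_cases hlc : c ≠ 0 ∨ l ≠ 0
      · obtain ⟨y, hy⟩ := exists_root_quadratic hlc n
        exact ⟨0, y, by linear_combination hy⟩
      push Not at hka hlc
      have hb : b ≠ 0 := fun hb => hne ⟨hka.2, hlc.2, hka.1, hb, hlc.1⟩
      obtain ⟨y, hy⟩ := exists_root_quadratic (Or.inl hb) (β := 0) n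
      exact ⟨y, y, by
        rw [hka.1, hka.2, hlc.1, hlc.2]
        linear_combination hy⟩
    exact ⟨v 1, v 2, z₁, w₁, hT, by linear_combination (v 1 * e1 + v 2 * e2) / 2, h1,
      by linear_combination e0 + z₁ * e1 + w₁ * e2⟩
  · obtain ⟨z₀, w₀, hT, hq⟩ : ∃ z₀ w₀ : ℂ, (z₀ ≠ 0 ∨ w₀ ≠ 0) ∧
        a * z₀ ^ 2 + b * z₀ * w₀ + c * w₀ ^ 2 = 0 := by
      by_cases ha : a = 0
      · exact ⟨1, 0, by simp, by rw [ha]; ring⟩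
      · obtain ⟨y, hy⟩ := exists_root_quadratic (Or.inl ha) (β := b) c
        exact ⟨y, 1, by simp, by linear_combination hy⟩
    refine ⟨z₀, w₀, v 1 / v 0, v 2 / v 0, hT, hq, ?_, ?_⟩
    · field_simp
      linear_combination (v 0 * e0 + v 1 * e1 + v 2 * e2) / 2
    · field_simp
      linear_combination z₀ * e1 + w₀ * e2

/-- If all conics were degenerate, each would contain a line other than ℓ unless it is the double
line x² = 0. Finiteness leaves x² = 0 for almost all t, so only n survives, and a zero of n,
possibly at t = ∞, gives a plane inside the surface. -/
theorem Represents.disc_ne_zero (h : Represents F e Q) (hfin : (linesOn F).Finite) :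
    Q.disc ≠ 0 := by
  intro hd
  have hB := (finite_parameters_of_lines hfin e).infinite_compl
  set B := {t | ∃ L ∈ linesOn F, L ≠ Submodule.span ℂ {e 2, e 3} ∧ L ≤ pencilPlane e t}
  have key : ∀ t ∈ Bᶜ, Q.k.eval t = 0 ∧ Q.l.eval t = 0 ∧ Q.a.eval t = 0 ∧ Q.b.eval t = 0 ∧
      Q.c.eval t = 0 := by
    intro t ht
    by_contra hne
    have hdt := congrArg (eval t) hd
    simp only [ConicFamily.disc, eval_sub, eval_add, eval_mul, eval_pow, eval_zero,
      eval_ofNat] at hdt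
    obtain ⟨z₀, w₀, z₁, w₁, hT, h1, h2, h3⟩ := exists_line_of_disc_eq_zero hdt hne
    apply ht
    have hli : LinearIndependent ℂ ![e 0 + t • e 1 + z₁ • e 2 + w₁ • e 3, z₀ • e 2 + w₀ • e 3] := by
      rcases hT with hT | hT
      · exact linearIndependent_pair_of_repr e (i := 0) (j := 2)
          (by simpa [Finsupp.single_apply] using hT)
      · exact linearIndependent_pair_of_repr e (i := 0) (j := 3)
          (by simpa [Finsupp.single_apply] using hT)
    refine ⟨Submodule.span ℂ {e 0 + t • e 1 + z₁ • e 2 + w₁ • e 3, z₀ • e 2 + w₀ • e 3},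
      ⟨isProjLine_span_pair hli, ?_⟩, ?_, ?_⟩
    · intro v hv
      obtain ⟨x, s, rfl⟩ := Submodule.mem_span_pair.mp hv
      rw [show x • (e 0 + t • e 1 + z₁ • e 2 + w₁ • e 3) + s • (z₀ • e 2 + w₀ • e 3)
        = x • (e 0 + t • e 1) + (x * z₁ + s * z₀) • e 2 + (x * w₁ + s * w₀) • e 3 by module,
        h.affine_point]
      linear_combination x ^ 4 * h2 + x ^ 2 * s ^ 2 * h1 + x ^ 3 * s * h3
    · intro hc
      have : e 0 + t • e 1 + z₁ • e 2 + w₁ • e 3 ∈ Submodule.span ℂ {e 2, e 3} := by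
        rw [← hc]
        exact Submodule.subset_span (by simp)
      have := (mem_span_iff_repr.mp this).1
      simp at this
    · rw [Submodule.span_le]
      rintro v (rfl | rfl)
      · exact mem_pencilPlane.mpr (by simp)
      · exact mem_pencilPlane.mpr (by simp)
  have zero : ∀ f : ℂ[X], (∀ t ∈ Bᶜ, f.eval t = 0) → f = 0 := fun f hf =>
    eq_zero_of_infinite_isRoot f (hB.mono hf)
  have hk := zero Q.k fun t ht => (key t ht).1
  have hl := zero Q.l fun t ht => (key t ht).2.1
  have ha := zero Q.a fun t ht => (key t ht).2.2.1
  have hb := zero Q.b fun t ht => (key t ht).2.2.2.1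
  have hc := zero Q.c fun t ht => (key t ht).2.2.2.2
  have hn : Q.n.degree = 0 := by
    by_contra hn
    obtain ⟨t, ht⟩ := IsAlgClosed.exists_root _ hn
    exact h.nonvanishing hfin t ⟨ht, by simp [hk], by simp [hl], by simp [ha], by simp [hb],
      by simp [hc]⟩
  have hn4 : Q.n.coeff 4 = 0 := coeff_eq_zero_of_degree_lt (by rw [hn]; norm_num)
  refine infinite_linesOn_of_plane (e := e) (u := e 1) ?_ ?_ hfin
  · simp
  · intro y z w
    rw [h.infinite, hn4, hk, hl, ha, hb, hc]
    simp

theorem ConicFamily.natDegree_disc_le (Q : ConicFamily) : Q.disc.natDegree ≤ 8 := by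
  have h4 : (4 * Q.n).natDegree ≤ 4 := by
    rw [← C_ofNat]; exact (natDegree_C_mul_le _ _).trans Q.hn
  have sq : ∀ {f : ℂ[X]} {i d : ℕ}, f.natDegree ≤ i → 2 * i ≤ d → (f ^ 2).natDegree ≤ d :=
    fun hf h => natDegree_pow_le.trans ((Nat.mul_le_mul_left 2 hf).trans h)
  have M := @natDegree_mul_le_of_add_le
  have S : ∀ {f g : ℂ[X]}, f.natDegree ≤ 8 → g.natDegree ≤ 8 → (f - g).natDegree ≤ 8 :=
    fun hf hg => natDegree_sub_le_of_le hf hg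
  refine S (S (S (natDegree_add_le_of_degree_le ?_ ?_) ?_) ?_) ?_
  · exact M (M h4 Q.ha le_rfl) Q.hc le_rfl
  · exact M (M Q.hk Q.hl le_rfl) Q.hb le_rfl
  · exact M Q.ha (sq Q.hl le_rfl) le_rfl
  · exact M Q.hc (sq Q.hk le_rfl) le_rfl
  · exact M Q.hn (sq Q.hb le_rfl) le_rfl

/-- The coefficient of t⁸ is the discriminant of the conic in the plane x = 0, so degree 8 says that
this conic is smooth. -/
theorem ConicFamily.coeff_disc (Q : ConicFamily) : Q.disc.coeff 8 =
    4 * Q.n.coeff 4 * Q.a.coeff 2 * Q.c.coeff 2 + Q.k.coeff 3 * Q.l.coeff 3 * Q.b.coeff 2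
      - Q.a.coeff 2 * Q.l.coeff 3 ^ 2 - Q.c.coeff 2 * Q.k.coeff 3 ^ 2
      - Q.n.coeff 4 * Q.b.coeff 2 ^ 2 := by
  have M := @natDegree_mul_le_of_add_le
  have e1 : (Q.n * Q.a * Q.c).coeff (4 + 2 + 2) = Q.n.coeff 4 * Q.a.coeff 2 * Q.c.coeff 2 := by
    rw [coeff_mul_add_eq_of_natDegree_le (M Q.hn Q.ha le_rfl) Q.hc,
      coeff_mul_add_eq_of_natDegree_le Q.hn Q.ha]
  have e2 : (Q.k * Q.l * Q.b).coeff (3 + 3 + 2) = Q.k.coeff 3 * Q.l.coeff 3 * Q.b.coeff 2 := by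
    rw [coeff_mul_add_eq_of_natDegree_le (M Q.hk Q.hl le_rfl) Q.hb,
      coeff_mul_add_eq_of_natDegree_le Q.hk Q.hl]
  have e3 : (Q.a * Q.l * Q.l).coeff (2 + 3 + 3) = Q.a.coeff 2 * Q.l.coeff 3 * Q.l.coeff 3 := by
    rw [coeff_mul_add_eq_of_natDegree_le (M Q.ha Q.hl le_rfl) Q.hl,
      coeff_mul_add_eq_of_natDegree_le Q.ha Q.hl]
  have e4 : (Q.c * Q.k * Q.k).coeff (2 + 3 + 3) = Q.c.coeff 2 * Q.k.coeff 3 * Q.k.coeff 3 := by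
    rw [coeff_mul_add_eq_of_natDegree_le (M Q.hc Q.hk le_rfl) Q.hk,
      coeff_mul_add_eq_of_natDegree_le Q.hc Q.hk]
  have e5 : (Q.n * Q.b * Q.b).coeff (4 + 2 + 2) = Q.n.coeff 4 * Q.b.coeff 2 * Q.b.coeff 2 := by
    rw [coeff_mul_add_eq_of_natDegree_le (M Q.hn Q.hb le_rfl) Q.hb,
      coeff_mul_add_eq_of_natDegree_le Q.hn Q.hb]
  have hd : Q.disc = C 4 * (Q.n * Q.a * Q.c) + Q.k * Q.l * Q.b - Q.a * Q.l * Q.l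
      - Q.c * Q.k * Q.k - Q.n * Q.b * Q.b := by
    rw [ConicFamily.disc, show (C 4 : ℂ[X]) = 4 from rfl]
    ring
  norm_num only at e1 e2 e3 e4 e5
  rw [hd, coeff_sub, coeff_sub, coeff_sub, coeff_add, coeff_C_mul, e1, e2, e3, e4, e5]
  ring

/-- The coefficients of a quadratic polynomial in two variables are determined by its values. -/
theorem quadratic_coeffs_eq {n k l a b c n' k' l' a' b' c' : ℂ}
    (h : ∀ z w : ℂ, n + (k * z + l * w) + a * z ^ 2 + b * z * w + c * w ^ 2
      = n' + (k' * z + l' * w) + a' * z ^ 2 + b' * z * w + c' * w ^ 2) :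
    n = n' ∧ k = k' ∧ l = l' ∧ a = a' ∧ b = b' ∧ c = c' := by
  have h0 := h 0 0
  have h1 := h 1 0
  have h2 := h (-1) 0
  have h3 := h 0 1
  have h4 := h 0 (-1)
  have h5 := h 1 1
  refine ⟨?_, ?_, ?_, ?_, ?_, ?_⟩
  · linear_combination h0
  · linear_combination (h1 - h2) / 2
  · linear_combination (h3 - h4) / 2
  · linear_combination (h1 + h2) / 2 - h0
  · linear_combination h5 - h1 - h3 + h0
  · linear_combination (h3 + h4) / 2 - h0

theorem exists_basis_of_repr (e : Module.Basis (Fin 4) ℂ (Fin 4 → ℂ)) (f : Fin 4 → Fin 4 → ℂ)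
    (hf : e.det f ≠ 0) : ∃ e' : Module.Basis (Fin 4) ℂ (Fin 4 → ℂ), ⇑e' = f := by
  obtain ⟨h1, h2⟩ := (e.is_basis_iff_det).mpr (Ne.isUnit hf)
  exact ⟨Module.Basis.mk h1 h2.ge, Module.Basis.coe_mk _ _⟩

/-- Coordinates for which the discriminant has the maximal degree. -/
theorem exists_generic_coordinates (hF : F.IsHomogeneous 4) (hfin : (linesOn F).Finite)
    {ℓ : Submodule ℂ (Fin 4 → ℂ)} (hℓ : IsLineOfDoublePoints F ℓ) :
    ∃ (e : Module.Basis (Fin 4) ℂ (Fin 4 → ℂ)) (Q : ConicFamily),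
      ℓ = Submodule.span ℂ {e 2, e 3} ∧ Represents F e Q ∧ Q.disc.natDegree = 8 := by
  obtain ⟨e, rfl⟩ := exists_basis_of_isProjLine hℓ.1
  have hs : ∀ z w : ℂ, MvPolynomial.eval (z • e 2 + w • e 3) F = 0 ∧
      ∀ i, MvPolynomial.eval (z • e 2 + w • e 3) (MvPolynomial.pderiv i F) = 0 :=
    fun z w => hℓ.2 _ (Submodule.mem_span_pair.mpr ⟨z, w, rfl⟩)
  obtain ⟨Q, hQ⟩ := exists_represents hF e hs
  have hd := hQ.disc_ne_zero hfin
  obtain ⟨t, ht⟩ : ∃ t, Q.disc.eval t ≠ 0 := by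
    by_contra! hc
    exact hd (Polynomial.funext fun t => by rw [hc, eval_zero])
  -- The plane over t, whose conic is smooth, is moved to infinity: it is spanned by ℓ and the new
  -- e' 1.
  obtain ⟨e', he'⟩ := exists_basis_of_repr e ![e 1, e 0 + t • e 1, e 2, e 3] (by
    rw [Module.Basis.det_apply, Matrix.det_succ_row_zero]
    simp [Fin.sum_univ_succ, Module.Basis.toMatrix_apply, det_fin_three,
      Fin.succAbove])
  have e1 : e' 1 = e 0 + t • e 1 := by rw [he']; rfl
  have e2 : e' 2 = e 2 := by rw [he']; rfl
  have e3 : e' 3 = e 3 := by rw [he']; rfl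
  obtain ⟨Q', hQ'⟩ := exists_represents hF e' (by rwa [e2, e3])
  refine ⟨e', Q', by rw [e2, e3], hQ', ?_⟩
  obtain ⟨h1, h2, h3, h4, h5, h6⟩ := quadratic_coeffs_eq (n := Q'.n.coeff 4) (k := Q'.k.coeff 3)
    (l := Q'.l.coeff 3) (a := Q'.a.coeff 2) (b := Q'.b.coeff 2) (c := Q'.c.coeff 2)
    (n' := Q.n.eval t) (k' := Q.k.eval t) (l' := Q.l.eval t) (a' := Q.a.eval t)
    (b' := Q.b.eval t) (c' := Q.c.eval t) (by
      intro z w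
      have i1 := hQ'.infinite 1 z w
      rw [e1, e2, e3, hQ.affine_point] at i1
      linear_combination -i1)
  refine natDegree_eq_of_le_of_coeff_ne_zero Q'.natDegree_disc_le ?_
  rw [Q'.coeff_disc, h1, h2, h3, h4, h5, h6]
  simpa [ConicFamily.disc] using ht

/-- The family of conics after a linear substitution in `z` and `w`. -/
noncomputable def ConicFamily.subst (Q : ConicFamily) (α β γ δ : ℂ) : ConicFamily where
  n := Q.n
  k := C α * Q.k + C β * Q.l
  l := C γ * Q.k + C δ * Q.l
  a := C (α ^ 2) * Q.a + C (α * β) * Q.b + C (β ^ 2) * Q.c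
  b := C (2 * α * γ) * Q.a + C (α * δ + β * γ) * Q.b + C (2 * β * δ) * Q.c
  c := C (γ ^ 2) * Q.a + C (γ * δ) * Q.b + C (δ ^ 2) * Q.c
  hn := Q.hn
  hk := natDegree_add_le_of_degree_le ((natDegree_C_mul_le _ _).trans Q.hk)
    ((natDegree_C_mul_le _ _).trans Q.hl)
  hl := natDegree_add_le_of_degree_le ((natDegree_C_mul_le _ _).trans Q.hk)
    ((natDegree_C_mul_le _ _).trans Q.hl)
  ha := natDegree_add_le_of_degree_le (natDegree_add_le_of_degree_le
    ((natDegree_C_mul_le _ _).trans Q.ha) ((natDegree_C_mul_le _ _).trans Q.hb))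
    ((natDegree_C_mul_le _ _).trans Q.hc)
  hb := natDegree_add_le_of_degree_le (natDegree_add_le_of_degree_le
    ((natDegree_C_mul_le _ _).trans Q.ha) ((natDegree_C_mul_le _ _).trans Q.hb))
    ((natDegree_C_mul_le _ _).trans Q.hc)
  hc := natDegree_add_le_of_degree_le (natDegree_add_le_of_degree_le
    ((natDegree_C_mul_le _ _).trans Q.ha) ((natDegree_C_mul_le _ _).trans Q.hb))
    ((natDegree_C_mul_le _ _).trans Q.hc)

theorem ConicFamily.disc_subst (Q : ConicFamily) (α β γ δ : ℂ) :
    (Q.subst α β γ δ).disc = C ((α * δ - β * γ) ^ 2) * Q.disc := by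
  simp only [disc, subst, C_mul, C_add, C_sub, C_pow]
  rw [show (C 2 : ℂ[X]) = 2 from rfl]
  ring

theorem Represents.subst (h : Represents F e Q) {α β γ δ : ℂ} (hd : α * δ - β * γ ≠ 0) :
    ∃ e' : Module.Basis (Fin 4) ℂ (Fin 4 → ℂ), e' 2 = α • e 2 + β • e 3 ∧
      e' 3 = γ • e 2 + δ • e 3 ∧ Submodule.span ℂ {e' 2, e' 3} = Submodule.span ℂ {e 2, e 3} ∧
      Represents F e' (Q.subst α β γ δ) := by
  obtain ⟨e', he'⟩ := exists_basis_of_repr e ![e 0, e 1, α • e 2 + β • e 3, γ • e 2 + δ • e 3] (by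
    rw [Module.Basis.det_apply, Matrix.det_succ_row_zero]
    simp [Fin.sum_univ_succ, Module.Basis.toMatrix_apply, det_fin_three,
      Fin.succAbove]
    rwa [mul_comm γ β])
  have e0 : e' 0 = e 0 := by rw [he']; rfl
  have e1 : e' 1 = e 1 := by rw [he']; rfl
  have e2 : e' 2 = α • e 2 + β • e 3 := by rw [he']; rfl
  have e3 : e' 3 = γ • e 2 + δ • e 3 := by rw [he']; rfl
  refine ⟨e', e2, e3, ?_, ?_, ?_⟩
  · refine span_pair_eq_of_isProjLine (isProjLine_span_basis e) ?_ ?_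
      (linearIndependent_pair_of_repr e' (i := 2) (j := 3) (by simp))
    · rw [e2]; exact Submodule.mem_span_pair.mpr ⟨_, _, rfl⟩
    · rw [e3]; exact Submodule.mem_span_pair.mpr ⟨_, _, rfl⟩
  · intro x t z w
    rw [e0, e1, e2, e3, show x • e 0 + (t * x) • e 1 + z • (α • e 2 + β • e 3)
      + w • (γ • e 2 + δ • e 3) = x • e 0 + (t * x) • e 1 + (z * α + w * γ) • e 2
        + (z * β + w * δ) • e 3 by module, h.affine]
    simp only [ConicFamily.subst, eval_add, eval_mul, eval_C]
    ring
  · intro y z w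
    rw [e1, e2, e3, show y • e 1 + z • (α • e 2 + β • e 3)
      + w • (γ • e 2 + δ • e 3) = y • e 1 + (z * α + w * γ) • e 2
        + (z * β + w * δ) • e 3 by module, h.infinite]
    simp only [ConicFamily.subst, coeff_add, coeff_C_mul]
    ring

/-- The line of the points `(1 : t : Z(t) : W(t))` of a section. -/
noncomputable def sectionLine (e : Module.Basis (Fin 4) ℂ (Fin 4 → ℂ)) (s : ℂ[X] × ℂ[X]) :
    Submodule ℂ (Fin 4 → ℂ) :=
  Submodule.span ℂ {e 0 + s.1.coeff 0 • e 2 + s.2.coeff 0 • e 3,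
    e 1 + s.1.coeff 1 • e 2 + s.2.coeff 1 • e 3}

theorem linearIndependent_section (e : Module.Basis (Fin 4) ℂ (Fin 4 → ℂ)) (α β γ δ : ℂ) :
    LinearIndependent ℂ ![e 0 + α • e 2 + β • e 3, e 1 + γ • e 2 + δ • e 3] :=
  linearIndependent_pair_of_repr e (i := 0) (j := 1) (by simp)

theorem Represents.sectionLine_mem (h : Represents F e Q) {s : ℂ[X] × ℂ[X]}
    (hs : s ∈ Q.sections) : sectionLine e s ∈ linesOn F := by
  refine ⟨isProjLine_span_pair (linearIndependent_section e _ _ _ _), fun v hv => ?_⟩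
  obtain ⟨x, y, rfl⟩ := Submodule.mem_span_pair.mp hv
  set f₀ := e 0 + s.1.coeff 0 • e 2 + s.2.coeff 0 • e 3 with hf₀
  set f₁ := e 1 + s.1.coeff 1 • e 2 + s.2.coeff 1 • e 3 with hf₁
  have hne : ∀ x y : ℂ, x ≠ 0 → MvPolynomial.eval (x • f₀ + y • f₁) F = 0 := by
    intro x y hx
    have h1 := congrArg (eval (y / x)) hs.2.2
    have hZ : s.1.eval (y / x) = s.1.coeff 1 * (y / x) + s.1.coeff 0 := by
      conv_lhs => rw [eq_X_add_C_of_natDegree_le_one hs.1]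
      simp
    have hW : s.2.eval (y / x) = s.2.coeff 1 * (y / x) + s.2.coeff 0 := by
      conv_lhs => rw [eq_X_add_C_of_natDegree_le_one hs.2.1]
      simp
    simp only [eval_add, eval_mul, eval_pow, hZ, hW, eval_zero] at h1
    have hyx : y / x * x = y := div_mul_cancel₀ y hx
    have h2 : x • f₀ + y • f₁ = x • e 0 + (y / x * x) • e 1
        + (x * (s.1.coeff 1 * (y / x) + s.1.coeff 0)) • e 2
        + (x * (s.2.coeff 1 * (y / x) + s.2.coeff 0)) • e 3 := by
      rw [hyx, show x * (s.1.coeff 1 * (y / x) + s.1.coeff 0) = s.1.coeff 1 * y + s.1.coeff 0 * x by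
        field_simp, show x * (s.2.coeff 1 * (y / x) + s.2.coeff 0)
          = s.2.coeff 1 * y + s.2.coeff 0 * x by field_simp, hf₀, hf₁]
      module
    rw [h2, h.affine]
    linear_combination x ^ 4 * h1
  by_cases hx : x = 0
  · rw [hx, zero_smul, zero_add]
    exact eval_eq_of_forall_ne (g := fun _ => 0) continuous_const fun x hx => hne x y hx
  · exact hne x y hx

theorem sectionLine_injOn (e : Module.Basis (Fin 4) ℂ (Fin 4 → ℂ)) (Q : ConicFamily) :
    Set.InjOn (sectionLine e) Q.sections := by
  intro s hs s' hs' h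
  have key : ∀ {v : Fin 4 → ℂ}, v ∈ sectionLine e s' →
      e.repr v 2 = e.repr v 0 * s'.1.coeff 0 + e.repr v 1 * s'.1.coeff 1 ∧
      e.repr v 3 = e.repr v 0 * s'.2.coeff 0 + e.repr v 1 * s'.2.coeff 1 := by
    intro v hv
    obtain ⟨x, y, rfl⟩ := Submodule.mem_span_pair.mp hv
    constructor <;> simp
  have h0 : e 0 + s.1.coeff 0 • e 2 + s.2.coeff 0 • e 3 ∈ sectionLine e s' := by
    rw [← h]; exact Submodule.subset_span (by simp)
  have h1 : e 1 + s.1.coeff 1 • e 2 + s.2.coeff 1 • e 3 ∈ sectionLine e s' := by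
    rw [← h]; exact Submodule.subset_span (by simp)
  have k0 := key h0
  have k1 := key h1
  simp at k0 k1
  refine Prod.ext ?_ ?_
  · rw [eq_X_add_C_of_natDegree_le_one hs.1, eq_X_add_C_of_natDegree_le_one hs'.1, k0.1, k1.1]
  · rw [eq_X_add_C_of_natDegree_le_one hs.2.1, eq_X_add_C_of_natDegree_le_one hs'.2.1, k0.2, k1.2]

theorem Represents.finite_sections (h : Represents F e Q) (hfin : (linesOn F).Finite) :
    Q.sections.Finite :=
  Set.Finite.of_finite_image (hfin.subset (Set.image_subset_iff.mpr fun _ hs =>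
    h.sectionLine_mem hs)) (sectionLine_injOn e Q)

/-- Every line disjoint from the double line comes from a section. -/
theorem Represents.exists_section (h : Represents F e Q) {L : Submodule ℂ (Fin 4 → ℂ)}
    (hL : L ∈ linesOn F) (hdisj : L ⊓ Submodule.span ℂ {e 2, e 3} = ⊥) :
    ∃ s ∈ Q.sections, sectionLine e s = L := by
  -- As ℂ⁴ = L ⊕ ℓ, every vector has a translate by ℓ in L; those of e 0 and e 1 span L and give the
  -- two linear polynomials.
  have htop : L ⊔ Submodule.span ℂ {e 2, e 3} = ⊤ := by
    apply Submodule.eq_top_of_finrank_eq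
    have h1 := Submodule.finrank_sup_add_finrank_inf_eq L (Submodule.span ℂ {e 2, e 3})
    rw [hdisj, finrank_bot, hL.1, isProjLine_span_basis e] at h1
    simpa using h1
  have key : ∀ u : Fin 4 → ℂ, ∃ z w : ℂ, u + z • e 2 + w • e 3 ∈ L := by
    intro u
    obtain ⟨m, hm, p, hp, hmp⟩ := Submodule.mem_sup.mp (htop ▸ Submodule.mem_top : u ∈ _)
    obtain ⟨z, w, rfl⟩ := Submodule.mem_span_pair.mp hp
    refine ⟨-z, -w, ?_⟩
    convert hm using 1
    rw [← hmp]
    module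
  obtain ⟨α, γ, h0⟩ := key (e 0)
  obtain ⟨β, δ, h1⟩ := key (e 1)
  refine ⟨(C β * X + C α, C δ * X + C γ), ⟨natDegree_linear_le, natDegree_linear_le, ?_⟩, ?_⟩
  · apply Polynomial.funext
    intro t
    have h2 := hL.2 _ (L.add_mem h0 (L.smul_mem t h1))
    rw [show e 0 + α • e 2 + γ • e 3 + t • (e 1 + β • e 2 + δ • e 3) = (1 : ℂ) • e 0
      + (t * 1) • e 1 + (β * t + α) • e 2 + (δ * t + γ) • e 3 by module, h.affine] at h2
    simp only [eval_add, eval_mul, eval_pow, eval_C, eval_X, eval_zero]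
    linear_combination h2
  · rw [sectionLine]
    simp only [coeff_add, coeff_C_mul, coeff_X_zero, coeff_X_one, coeff_C_zero, mul_zero, zero_add,
      mul_one, coeff_C_succ, add_zero]
    exact span_pair_eq_of_isProjLine hL.1 h0 h1 (linearIndependent_section e _ _ _ _)

/-- The line through the point `e 3` corresponding to a ray. -/
noncomputable def rayLine (e : Module.Basis (Fin 4) ℂ (Fin 4 → ℂ)) (r : ℂ × ℂ) :
    Submodule ℂ (Fin 4 → ℂ) := Submodule.span ℂ {e 3, e 0 + r.1 • e 1 + r.2 • e 2}

/-- L lies in a plane of the pencil. In the plane x = 0 it would be a component of the conic there,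
which is smooth by the degree of the discriminant. In a plane y = t x, vanishing for all w gives the
two ray equations. -/
theorem Represents.exists_ray (h : Represents F e Q) (hd : Q.disc.natDegree = 8) (hc : Q.c = 0)
    {L : Submodule ℂ (Fin 4 → ℂ)} (hL : L ∈ linesOn F)
    (hne : L ≠ Submodule.span ℂ {e 2, e 3}) (h3 : e 3 ∈ L) : ∃ r ∈ Q.rays, rayLine e r = L := by
  obtain ⟨v, hv, hvℓ⟩ : ∃ v ∈ L, v ∉ Submodule.span ℂ {e 2, e 3} := by
    by_contra! hcon
    exact hne (Submodule.eq_of_le_of_finrank_eq hcon (hL.1.trans (isProjLine_span_basis e).symm))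
  rw [mem_span_iff_repr, not_and_or] at hvℓ
  have hvd := e.eq_combination v
  set x := e.repr v 0
  set y := e.repr v 1
  set z := e.repr v 2
  set w := e.repr v 3
  have lin : ∀ {p q : ℂ}, (∀ w : ℂ, p + q * w = 0) → p = 0 ∧ q = 0 := by
    intro p q hpq
    have h0 := hpq 0
    have h1 := hpq 1
    exact ⟨by linear_combination h0, by linear_combination h1 - h0⟩
  by_cases hx : x = 0
  · have hy : y ≠ 0 := hvℓ.resolve_left (not_not.mpr hx)
    exfalso
    have h1 : ∀ w' : ℂ, MvPolynomial.eval ((1 : ℂ) • e 1 + (z / y) • e 2 + w' • e 3) F = 0 := by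
      intro w'
      have h2 := L.add_mem (L.smul_mem y⁻¹ hv) (L.smul_mem (w' - w / y) h3)
      have h4 : (1 : ℂ) • e 1 + (z / y) • e 2 + w' • e 3 = y⁻¹ • v + (w' - w / y) • e 3 := by
        rw [hvd, hx]
        simp only [smul_add, smul_smul, inv_mul_cancel₀ hy, zero_smul, zero_add]
        rw [show y⁻¹ * z = z / y by ring, show y⁻¹ * w = w / y by ring]
        module
      rw [h4]
      exact hL.2 _ h2
    have h8 : Q.disc.coeff 8 ≠ 0 := by
      rw [← hd, coeff_natDegree]
      intro h0
      rw [leadingCoeff_eq_zero] at h0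
      simp [h0] at hd
    apply h8
    obtain ⟨e1, e2⟩ := lin (p := Q.n.coeff 4 + Q.k.coeff 3 * (z / y) + Q.a.coeff 2 * (z / y) ^ 2)
      (q := Q.l.coeff 3 + Q.b.coeff 2 * (z / y)) (by
        intro w'
        have h2 := h1 w'
        rw [h.infinite, hc, coeff_zero] at h2
        linear_combination h2)
    rw [Q.coeff_disc, hc, coeff_zero]
    linear_combination (Q.k.coeff 3 * Q.b.coeff 2 + Q.a.coeff 2 * (Q.b.coeff 2 * (z / y))
        - Q.a.coeff 2 * Q.l.coeff 3) * e2 - (Q.b.coeff 2) ^ 2 * e1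
  · have hv' : e 0 + (y / x) • e 1 + (z / x) • e 2 ∈ L := by
      have h2 := L.add_mem (L.smul_mem x⁻¹ hv) (L.smul_mem (- (w / x)) h3)
      convert h2 using 1
      rw [hvd]
      simp only [smul_add, smul_smul, inv_mul_cancel₀ hx]
      rw [show x⁻¹ * z = z / x by ring, show x⁻¹ * w = w / x by ring,
        show x⁻¹ * y = y / x by ring]
      module
    obtain ⟨e1, e2⟩ := lin (p := Q.n.eval (y / x) + Q.k.eval (y / x) * (z / x)
        + Q.a.eval (y / x) * (z / x) ^ 2)
      (q := Q.l.eval (y / x) + Q.b.eval (y / x) * (z / x)) (by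
        intro w'
        have h2 := hL.2 _ (L.add_mem hv' (L.smul_mem w' h3))
        rw [show e 0 + (y / x) • e 1 + (z / x) • e 2 + w' • e 3 = (1 : ℂ) • e 0
          + (y / x * 1) • e 1 + (z / x) • e 2 + w' • e 3 by module, h.affine, hc, eval_zero] at h2
        linear_combination h2)
    refine ⟨(y / x, z / x), ⟨by linear_combination e2, by linear_combination e1⟩, ?_⟩
    exact span_pair_eq_of_isProjLine hL.1 h3 hv'
      (linearIndependent_pair_of_repr e (i := 3) (j := 0) (by simp))

end Coordinates

/-! ### Counting the lines. -/

theorem encard_le_of_forall_finset {α : Type*} {S : Set α} {N : ℕ}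
    (h : ∀ I : Finset α, ↑I ⊆ S → I.card ≤ N) : S.encard ≤ N := by
  by_contra! hlt
  obtain ⟨T, hTS, hT⟩ := Set.exists_subset_encard_eq (Order.add_one_le_of_lt hlt)
  have hfin : T.Finite := Set.finite_of_encard_eq_coe (k := N + 1) (by rw [hT]; rfl)
  have h1 := h hfin.toFinset (by simpa using hTS)
  rw [hfin.encard_eq_coe_toFinset_card] at hT
  have h2 : hfin.toFinset.card = N + 1 := by exact_mod_cast hT
  omega

section Coordinates

variable {F : MvPolynomial (Fin 4) ℂ} {e : Module.Basis (Fin 4) ℂ (Fin 4 → ℂ)}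
  {Q : ConicFamily}

theorem Represents.encard_disjoint_le (h : Represents F e Q) {N : ℕ}
    (hN : ∀ I : Finset (ℂ[X] × ℂ[X]), ↑I ⊆ Q.sections → I.card ≤ N) :
    {L ∈ linesOn F | L ⊓ Submodule.span ℂ {e 2, e 3} = ⊥}.encard ≤ N := by
  refine le_trans (Set.encard_le_encard ?_)
    ((Set.encard_image_le (sectionLine e) _).trans (encard_le_of_forall_finset hN))
  rintro L ⟨hL, hdisj⟩
  exact h.exists_section hL hdisj

theorem Represents.encard_through_le (h : Represents F e Q) (hd : Q.disc.natDegree = 8)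
    (hc : Q.c = 0) {N : ℕ} (hN : ∀ I : Finset (ℂ × ℂ), ↑I ⊆ Q.rays → I.card ≤ N) :
    {L ∈ linesOn F | L ≠ Submodule.span ℂ {e 2, e 3} ∧ e 3 ∈ L}.encard ≤ N := by
  refine le_trans (Set.encard_le_encard ?_)
    ((Set.encard_image_le (rayLine e) _).trans (encard_le_of_forall_finset hN))
  rintro L ⟨hL, hne, h3⟩
  exact h.exists_ray hd hc hL hne h3

/-- The lines through a base point of the family of conics, except for the double line. -/
def linesThroughBasePoints (F : MvPolynomial (Fin 4) ℂ) (e : Module.Basis (Fin 4) ℂ (Fin 4 → ℂ))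
    (Q : ConicFamily) : Set (Submodule ℂ (Fin 4 → ℂ)) :=
  {L ∈ linesOn F | L ≠ Submodule.span ℂ {e 2, e 3} ∧
    ∃ t ∈ Q.basePoints, t.1 • e 2 + t.2 • e 3 ∈ L}

theorem combination_mem_of_proportional {L : Submodule ℂ (Fin 4 → ℂ)} {u v : Fin 4 → ℂ}
    {t t' : ℂ × ℂ} (ht' : t' ≠ 0) (h : t.1 * t'.2 - t.2 * t'.1 = 0)
    (hL : t'.1 • u + t'.2 • v ∈ L) : t.1 • u + t.2 • v ∈ L := by
  by_cases h1 : t'.1 = 0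
  · have h2 : t'.2 ≠ 0 := fun h2 => ht' (Prod.ext h1 h2)
    have h3 : t.1 = 0 := by
      rw [h1, mul_zero, sub_zero] at h
      exact (mul_eq_zero.mp h).resolve_right h2
    have := L.smul_mem (t.2 / t'.2) hL
    rwa [h1, zero_smul, zero_add, smul_smul, div_mul_cancel₀ _ h2,
      ← zero_add (t.2 • v), ← zero_smul ℂ u, ← h3] at this
  · have := L.smul_mem (t.1 / t'.1) hL
    rwa [smul_add, smul_smul, smul_smul, div_mul_cancel₀ _ h1,
      show t.1 / t'.1 * t'.2 = t.2 by field_simp; linear_combination h] at this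

theorem ConicFamily.c_subst_eq_zero {t : ℂ × ℂ} (ht : t ∈ Q.basePoints) (α β : ℂ) :
    (Q.subst α β t.1 t.2).c = 0 := by
  simp only [subst, C_mul, C_pow]
  linear_combination ht.2

theorem ConicFamily.a_subst_eq_zero {t : ℂ × ℂ} (ht : t ∈ Q.basePoints) (γ δ : ℂ) :
    (Q.subst t.1 t.2 γ δ).a = 0 := by
  simp only [subst, C_mul, C_pow]
  linear_combination ht.2

theorem ConicFamily.natDegree_disc_subst (hd : Q.disc.natDegree = 8) {α β γ δ : ℂ}
    (h : α * δ - β * γ ≠ 0) : (Q.subst α β γ δ).disc.natDegree = 8 := by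
  rw [disc_subst, natDegree_C_mul (pow_ne_zero 2 h), hd]

theorem ConicFamily.disc_ne_zero_of_natDegree (hd : Q.disc.natDegree = 8) : Q.disc ≠ 0 := by
  intro h
  simp [h] at hd

/-- All but finitely many residual conics meet only lines of this set. -/
theorem Represents.encard_lines_le (h : Represents F e Q) (hfin : (linesOn F).Finite)
    (hd : Q.disc.natDegree = 8) :
    ({Submodule.span ℂ {e 2, e 3}} ∪ {L ∈ linesOn F | L ⊓ Submodule.span ℂ {e 2, e 3} = ⊥}
      ∪ linesThroughBasePoints F e Q).encard ≤ 19 := by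
  have hQ := h.nonvanishing hfin
  have total : ∀ {N M : ℕ}, {L ∈ linesOn F | L ⊓ Submodule.span ℂ {e 2, e 3} = ⊥}.encard ≤ N →
      (linesThroughBasePoints F e Q).encard ≤ M → 1 + N + M ≤ 19 →
      ({Submodule.span ℂ {e 2, e 3}} ∪ {L ∈ linesOn F | L ⊓ Submodule.span ℂ {e 2, e 3} = ⊥}
        ∪ linesThroughBasePoints F e Q).encard ≤ 19 := by
    intro N M hN hM hNM
    refine (Set.encard_union_le _ _).trans ((add_le_add (Set.encard_union_le _ _) le_rfl).trans ?_)
    rw [Set.encard_singleton]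
    refine (add_le_add (add_le_add le_rfl hN) hM).trans ?_
    exact_mod_cast hNM
  -- The cases are two, one or no base points up to proportionality; the totals 1 + 4 + 12, 1 + 8 +
  -- 8 and 1 + 16 + 0 are all 17.
  by_cases h1 : ∃ t, t ∈ Q.basePoints
  · obtain ⟨t, ht⟩ := h1
    by_cases h2 : ∃ t' ∈ Q.basePoints, t.1 * t'.2 - t.2 * t'.1 ≠ 0
    · obtain ⟨t', ht', hne⟩ := h2
      have hne' : t'.1 * t.2 - t'.2 * t.1 ≠ 0 := fun h0 => hne (by linear_combination -h0)
      have hd1 := ConicFamily.natDegree_disc_subst hd hne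
      have hd2 := ConicFamily.natDegree_disc_subst hd hne'
      -- Rays pass through the last basis vector, so each base point gets its own basis: t' is last
      -- in e₁ and t is last in e₂.
      obtain ⟨e₁, -, h13, hs1, hr1⟩ := h.subst hne
      obtain ⟨e₂, -, h23, hs2, hr2⟩ := h.subst hne'
      have ha1 := ConicFamily.a_subst_eq_zero ht t'.1 t'.2
      have ha2 := ConicFamily.a_subst_eq_zero ht' t.1 t.2
      have hc1 := ConicFamily.c_subst_eq_zero ht' t.1 t.2
      have hc2 := ConicFamily.c_subst_eq_zero ht t'.1 t'.2
      have b1 := hr1.encard_through_le hd1 hc1 (ConicFamily.card_rays_le_of_two_basePoints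
        (hr1.nonvanishing hfin) (ConicFamily.disc_ne_zero_of_natDegree hd1) ha1 hc1)
      have b2 := hr2.encard_through_le hd2 hc2 (ConicFamily.card_rays_le_of_two_basePoints
        (hr2.nonvanishing hfin) (ConicFamily.disc_ne_zero_of_natDegree hd2) ha2 hc2)
      rw [hs1, h13] at b1
      rw [hs2, h23] at b2
      refine total (N := 4) (M := 12) (h.encard_disjoint_le
        (ConicFamily.card_sections_le_of_two_basePoints hQ hd ht ht' hne)) ?_ (by norm_num)
      refine le_trans (Set.encard_le_encard ?_) ((Set.encard_union_le _ _).trans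
        ((add_le_add b1 b2).trans (by norm_num)))
      rintro L ⟨hL, hLne, s, hs, hsL⟩
      have hb : (Q.subst t.1 t.2 t'.1 t'.2).b ≠ 0 := by
        intro hb
        apply ConicFamily.disc_ne_zero_of_natDegree hd1
        rw [ConicFamily.disc, ha1, hb, hc1]
        ring
      -- In the basis t, t' of ℓ the form is b times the product of the two coordinates. As b ≠ 0, a
      -- base point s is proportional to t or t'.
      have hprod : C ((s.1 * t'.2 - s.2 * t'.1) * (t.1 * s.2 - t.2 * s.1))
          * (Q.subst t.1 t.2 t'.1 t'.2).b = 0 := by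
        have e0 := hs.2
        have e1 := ht.2
        have e2 := ht'.2
        simp only [ConicFamily.subst, C_mul, C_add, C_sub]
        rw [show (C 2 : ℂ[X]) = 2 from rfl]
        linear_combination (C t.1 * C t'.2 - C t.2 * C t'.1) ^ 2 * e0
          - (C s.1 * C t'.2 - C s.2 * C t'.1) ^ 2 * e1 - (C t.1 * C s.2 - C t.2 * C s.1) ^ 2 * e2
      have hprod' := C_eq_zero.mp ((mul_eq_zero.mp hprod).resolve_right hb)
      rcases mul_eq_zero.mp hprod' with h0 | h0
      · exact Or.inl ⟨hL, hLne, combination_mem_of_proportional hs.1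
          (by linear_combination -h0) hsL⟩
      · exact Or.inr ⟨hL, hLne, combination_mem_of_proportional hs.1
          (by linear_combination h0) hsL⟩
    · push Not at h2
      obtain ⟨α, β, hαβ⟩ : ∃ α β : ℂ, α * t.2 - β * t.1 ≠ 0 := by
        by_cases h0 : t.1 = 0
        · refine ⟨1, 0, ?_⟩
          simpa using fun h2 => ht.1 (Prod.ext h0 h2)
        · exact ⟨0, 1, by simpa using h0⟩
      have hd1 := ConicFamily.natDegree_disc_subst hd hαβ
      obtain ⟨e₁, -, h13, hs1, hr1⟩ := h.subst hαβ
      have hc1 := ConicFamily.c_subst_eq_zero ht α β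
      have b1 := hr1.encard_through_le hd1 hc1
        (ConicFamily.card_rays_le (hr1.nonvanishing hfin) hd1 hc1)
      rw [hs1, h13] at b1
      refine total (N := 8) (M := 8) (h.encard_disjoint_le
        (ConicFamily.card_sections_le_of_basePoint hQ hd ht)) ?_ (by norm_num)
      refine le_trans (Set.encard_le_encard ?_) b1
      rintro L ⟨hL, hLne, s, hs, hsL⟩
      exact ⟨hL, hLne, combination_mem_of_proportional hs.1 (h2 s hs) hsL⟩
  · refine total (N := 16) (M := 0) (h.encard_disjoint_le
      (ConicFamily.card_sections_le hQ hd (h.finite_sections hfin))) ?_ (by norm_num)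
    have : linesThroughBasePoints F e Q = ∅ := by
      ext L
      simp only [Set.mem_empty_iff_false, iff_false]
      rintro ⟨-, -, s, hs, -⟩
      exact h1 ⟨s, hs⟩
    simp [this]

/-! ### Residual conics and the exceptional planes. -/

/-- For all but finitely many `t`, the conic over `t` meets a line different from the double line
in a point of the double line only if that point is a base point. -/
theorem finite_exceptional_parameters (hfin : (linesOn F).Finite)
    (e : Module.Basis (Fin 4) ℂ (Fin 4 → ℂ)) (Q : ConicFamily) :
    {t | ∃ L ∈ linesOn F, L ≠ Submodule.span ℂ {e 2, e 3} ∧ ∃ r : ℂ × ℂ, r ≠ 0 ∧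
      r ∉ Q.basePoints ∧ r.1 • e 2 + r.2 • e 3 ∈ L ∧
      Q.a.eval t * r.1 ^ 2 + Q.b.eval t * r.1 * r.2 + Q.c.eval t * r.2 ^ 2 = 0}.Finite := by
  have key : ∀ L ∈ linesOn F, {t | L ≠ Submodule.span ℂ {e 2, e 3} ∧ ∃ r : ℂ × ℂ, r ≠ 0 ∧
      r ∉ Q.basePoints ∧ r.1 • e 2 + r.2 • e 3 ∈ L ∧
      Q.a.eval t * r.1 ^ 2 + Q.b.eval t * r.1 * r.2 + Q.c.eval t * r.2 ^ 2 = 0}.Finite := by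
    intro L hL
    by_cases hr : L ≠ Submodule.span ℂ {e 2, e 3} ∧ ∃ r : ℂ × ℂ, r ≠ 0 ∧ r ∉ Q.basePoints ∧
        r.1 • e 2 + r.2 • e 3 ∈ L
    · obtain ⟨hne, r, hr0, hrb, hrL⟩ := hr
      have hp : Q.a * C r.1 ^ 2 + Q.b * C r.1 * C r.2 + Q.c * C r.2 ^ 2 ≠ 0 :=
        fun h0 => hrb ⟨hr0, h0⟩
      refine (finite_setOfPred_isRoot hp).subset ?_
      rintro t ⟨-, s, hs0, -, hsL, hst⟩
      -- L meets ℓ in one point only, so s is proportional to r and t is a root of the nonzero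
      -- polynomial attached to r.
      have hprop : r.1 * s.2 - r.2 * s.1 = 0 := by
        by_contra hind
        apply hne
        have hli : LinearIndependent ℂ ![r.1 • e 2 + r.2 • e 3, s.1 • e 2 + s.2 • e 3] :=
          linearIndependent_pair_of_repr e (i := 2) (j := 3) (by simpa using hind)
        rw [← span_pair_eq_of_isProjLine hL.1 hrL hsL hli]
        exact span_pair_eq_of_isProjLine (isProjLine_span_basis e)
          (Submodule.mem_span_pair.mpr ⟨_, _, rfl⟩) (Submodule.mem_span_pair.mpr ⟨_, _, rfl⟩) hli
      simp only [Set.mem_ofPred_eq, IsRoot.def, eval_add, eval_mul, eval_pow, eval_C]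
      by_cases h1 : s.1 = 0
      · have h2 : s.2 ≠ 0 := fun h2 => hs0 (Prod.ext h1 h2)
        apply mul_left_cancel₀ (pow_ne_zero 2 h2)
        rw [h1] at hprop hst
        have h3 : r.1 = 0 := by
          rw [mul_zero, sub_zero] at hprop
          exact (mul_eq_zero.mp hprop).resolve_right h2
        rw [h3]
        linear_combination r.2 ^ 2 * hst
      · apply mul_left_cancel₀ (pow_ne_zero 2 h1)
        have h3 : r.2 * s.1 = r.1 * s.2 := by linear_combination -hprop
        linear_combination r.1 ^ 2 * hst + Q.b.eval t * r.1 * s.1 * h3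
          + Q.c.eval t * (r.2 * s.1 + r.1 * s.2) * h3
    · refine Set.finite_empty.subset ?_
      rintro t ⟨hne, r, hr0, hrb, hrL, -⟩
      exact hr ⟨hne, r, hr0, hrb, hrL⟩
  refine (hfin.biUnion key).subset ?_
  rintro t ⟨L, hL, h⟩
  exact Set.mem_biUnion hL h

/-- The conic over `t`, as a quadratic form on the whole space. -/
theorem exists_residual_form (e : Module.Basis (Fin 4) ℂ (Fin 4 → ℂ)) (n k l a b c : ℂ) :
    ∃ q : MvPolynomial (Fin 4) ℂ, q.IsHomogeneous 2 ∧ ∀ v, MvPolynomial.eval v q =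
      n * e.repr v 0 ^ 2 + e.repr v 0 * (k * e.repr v 2 + l * e.repr v 3)
        + a * e.repr v 2 ^ 2 + b * e.repr v 2 * e.repr v 3 + c * e.repr v 3 ^ 2 := by
  set x : Fin 4 → MvPolynomial (Fin 4) ℂ := fun i =>
    ∑ j, MvPolynomial.C (e.repr (Pi.single j 1) i) * MvPolynomial.X j with hx
  have hxh : ∀ i, (x i).IsHomogeneous 1 := fun i =>
    MvPolynomial.IsHomogeneous.sum _ _ _ fun j _ => MvPolynomial.isHomogeneous_C_mul_X _ j
  have hxe : ∀ i v, MvPolynomial.eval v (x i) = e.repr v i := by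
    intro i v
    have h1 : v = ∑ j, v j • (Pi.single j 1 : Fin 4 → ℂ) := by
      conv_lhs => rw [pi_eq_sum_univ' v]
    conv_rhs => rw [h1]
    simp [hx, mul_comm]
  have hm : ∀ (s : ℂ) i j, (MvPolynomial.C s * (x i * x j)).IsHomogeneous 2 := fun s i j => by
    simpa using ((hxh i).mul (hxh j)).C_mul s
  refine ⟨MvPolynomial.C n * (x 0 * x 0) + MvPolynomial.C k * (x 0 * x 2)
    + MvPolynomial.C l * (x 0 * x 3) + MvPolynomial.C a * (x 2 * x 2)
    + MvPolynomial.C b * (x 2 * x 3) + MvPolynomial.C c * (x 3 * x 3), ?_, fun v => ?_⟩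
  · exact (((((hm _ _ _).add (hm _ _ _)).add (hm _ _ _)).add (hm _ _ _)).add (hm _ _ _)).add
      (hm _ _ _)
  · simp only [map_add, map_mul, MvPolynomial.eval_C, hxe]
    ring

theorem Represents.eval_of_mem (h : Represents F e Q) {t : ℂ} {v : Fin 4 → ℂ}
    (hv : v ∈ pencilPlane e t) : MvPolynomial.eval v F = e.repr v 0 ^ 2 *
      (Q.n.eval t * e.repr v 0 ^ 2 + e.repr v 0 * (Q.k.eval t * e.repr v 2
        + Q.l.eval t * e.repr v 3) + Q.a.eval t * e.repr v 2 ^ 2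
        + Q.b.eval t * e.repr v 2 * e.repr v 3 + Q.c.eval t * e.repr v 3 ^ 2) := by
  conv_lhs => rw [e.eq_combination v, mem_pencilPlane.mp hv]
  rw [h.affine]

theorem Represents.exists_residualConic (h : Represents F e Q) (hQ : Q.Nonvanishing) (t : ℂ) :
    ∃ q, IsResidualConic F (Submodule.span ℂ {e 2, e 3}) (pencilPlane e t) q := by
  obtain ⟨q, hq, hqe⟩ := exists_residual_form e (Q.n.eval t) (Q.k.eval t) (Q.l.eval t)
    (Q.a.eval t) (Q.b.eval t) (Q.c.eval t)
  refine ⟨q, hq, ?_, e.coord 0, ?_, fun v hv => ?_⟩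
  · by_contra! hc
    apply hQ t
    obtain ⟨h1, h2, h3, h4, h5, h6⟩ := quadratic_coeffs_eq (n := Q.n.eval t) (k := Q.k.eval t)
      (l := Q.l.eval t) (a := Q.a.eval t) (b := Q.b.eval t) (c := Q.c.eval t) (n' := 0) (k' := 0)
      (l' := 0) (a' := 0) (b' := 0) (c' := 0) (by
        intro z w
        obtain ⟨r0, r1, r2, r3⟩ := e.repr_combination 1 t z w
        have h1 := hc ((1 : ℂ) • e 0 + t • e 1 + z • e 2 + w • e 3)
          (mem_pencilPlane.mpr (by rw [r0, r1, mul_one]))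
        rw [hqe, r0, r2, r3] at h1
        linear_combination h1)
    exact ⟨h1, h2, h3, h4, h5, h6⟩
  · ext v
    rw [Submodule.mem_inf, mem_span_iff_repr, mem_pencilPlane, LinearMap.mem_ker,
      Module.Basis.coord_apply]
    constructor
    · rintro ⟨h1, h2⟩
      exact ⟨h2, by rw [h1, h2, mul_zero]⟩
    · rintro ⟨h1, h2⟩
      exact ⟨by rw [h1, h2, mul_zero], h1⟩
  · rw [hqe, h.eval_of_mem hv, Module.Basis.coord_apply]

/-- Every equation of the residual conic vanishes only on the conic of the family. -/
theorem Represents.eq_zero_of_residualConic (h : Represents F e Q) {t : ℂ}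
    {q : MvPolynomial (Fin 4) ℂ}
    (hq : IsResidualConic F (Submodule.span ℂ {e 2, e 3}) (pencilPlane e t) q) {v : Fin 4 → ℂ}
    (hv : v ∈ pencilPlane e t) (hqv : MvPolynomial.eval v q = 0) :
    Q.n.eval t * e.repr v 0 ^ 2 + e.repr v 0 * (Q.k.eval t * e.repr v 2
        + Q.l.eval t * e.repr v 3) + Q.a.eval t * e.repr v 2 ^ 2
        + Q.b.eval t * e.repr v 2 * e.repr v 3 + Q.c.eval t * e.repr v 3 ^ 2 = 0 := by
  obtain ⟨-, -, m, hm, hFm⟩ := hq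
  have hmℓ : ∀ z w : ℂ, m (z • e 2 + w • e 3) = 0 := by
    intro z w
    have h1 : z • e 2 + w • e 3 ∈ Submodule.span ℂ {e 2, e 3} :=
      Submodule.mem_span_pair.mpr ⟨_, _, rfl⟩
    rw [← hm] at h1
    exact h1.2
  set u := e 0 + t • e 1 with hu
  have hdec : ∀ w ∈ pencilPlane e t,
      w = e.repr w 0 • u + (e.repr w 2 • e 2 + e.repr w 3 • e 3) := by
    intro w hw
    conv_lhs => rw [e.eq_combination w, mem_pencilPlane.mp hw]
    rw [hu]
    module
  have huH : u ∈ pencilPlane e t := mem_pencilPlane.mpr (by simp [hu])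
  have hmu : m u ≠ 0 := by
    intro h0
    have h1 : u ∈ pencilPlane e t ⊓ LinearMap.ker m := ⟨huH, h0⟩
    rw [hm, mem_span_iff_repr] at h1
    simp [hu] at h1
  have hne : ∀ w ∈ pencilPlane e t, e.repr w 0 ≠ 0 → MvPolynomial.eval w q = (m u ^ 2)⁻¹ *
      (Q.n.eval t * e.repr w 0 ^ 2 + e.repr w 0 * (Q.k.eval t * e.repr w 2
        + Q.l.eval t * e.repr w 3) + Q.a.eval t * e.repr w 2 ^ 2
        + Q.b.eval t * e.repr w 2 * e.repr w 3 + Q.c.eval t * e.repr w 3 ^ 2) := by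
    intro w hw hw0
    have h1 := hFm w hw
    have h2 : m w = e.repr w 0 * m u := by
      conv_lhs => rw [hdec w hw, map_add, hmℓ, map_smul, smul_eq_mul, add_zero]
    rw [h.eval_of_mem hw, h2] at h1
    rw [eq_inv_mul_iff_mul_eq₀ (pow_ne_zero 2 hmu)]
    apply mul_left_cancel₀ (pow_ne_zero 2 hw0)
    linear_combination -h1
  -- Comparing q with the conic cancels x², which says nothing on ℓ; points of ℓ are reached as
  -- limits along u.
  by_cases h0 : e.repr v 0 = 0
  · have h1 : ∀ x : ℂ, x ≠ 0 → MvPolynomial.eval (x • u + v) q = (m u ^ 2)⁻¹ *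
        (Q.n.eval t * x ^ 2 + x * (Q.k.eval t * e.repr v 2
        + Q.l.eval t * e.repr v 3) + Q.a.eval t * e.repr v 2 ^ 2
        + Q.b.eval t * e.repr v 2 * e.repr v 3 + Q.c.eval t * e.repr v 3 ^ 2) := by
      intro x hx
      have r0 : e.repr (x • u + v) 0 = x := by simp [hu, h0]
      have r2 : e.repr (x • u + v) 2 = e.repr v 2 := by simp [hu]
      have r3 : e.repr (x • u + v) 3 = e.repr v 3 := by simp [hu]
      have := hne (x • u + v) ((pencilPlane e t).add_mem ((pencilPlane e t).smul_mem x huH) hv)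
        (by rwa [r0])
      rwa [r0, r2, r3] at this
    have h2 := eval_eq_of_forall_ne (by fun_prop) h1
    rw [hqv] at h2
    rw [h0]
    exact (mul_eq_zero.mp h2.symm).resolve_left (inv_ne_zero (pow_ne_zero 2 hmu))
  · have h1 := hne v hv h0
    rw [hqv] at h1
    exact (mul_eq_zero.mp h1.symm).resolve_left (inv_ne_zero (pow_ne_zero 2 hmu))

/-- The planes through the double line are the planes `y = t x` and the plane `x = 0`. -/
theorem eq_pencilPlane_or_eq {H : Submodule ℂ (Fin 4 → ℂ)}
    (hH : H ∈ planesThrough (Submodule.span ℂ {e 2, e 3})) :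
    (∃ t, H = pencilPlane e t) ∨ H = Submodule.span ℂ {e 1} ⊔ Submodule.span ℂ {e 2, e 3} := by
  obtain ⟨hr, hle⟩ := hH
  have hℓ := isProjLine_span_basis e
  obtain ⟨v, hv, hvℓ⟩ : ∃ v ∈ H, v ∉ Submodule.span ℂ {e 2, e 3} := by
    by_contra! hc
    have h1 := Submodule.finrank_mono (show H ≤ _ from hc)
    rw [hr, hℓ] at h1
    omega
  have gen : ∀ u ∈ H, u ∉ Submodule.span ℂ {e 2, e 3} →
      Submodule.span ℂ {u} ⊔ Submodule.span ℂ {e 2, e 3} = H := by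
    intro u hu huℓ
    refine Submodule.eq_of_le_of_finrank_le
      (sup_le ((Submodule.span_singleton_le_iff_mem u H).mpr hu) hle) ?_
    have h1 : Submodule.span ℂ {e 2, e 3} < Submodule.span ℂ {u} ⊔ Submodule.span ℂ {e 2, e 3} := by
      refine lt_of_le_of_ne le_sup_right fun h0 => huℓ ?_
      rw [h0]
      exact Submodule.mem_sup_left (Submodule.mem_span_singleton_self u)
    have h2 := Submodule.finrank_lt_finrank_of_lt h1
    rw [hℓ] at h2
    rw [hr]
    omega
  have h23 : ∀ z w : ℂ, z • e 2 + w • e 3 ∈ H := fun z w =>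
    hle (Submodule.mem_span_pair.mpr ⟨_, _, rfl⟩)
  have hvd := e.eq_combination v
  by_cases h0 : e.repr v 0 = 0
  · right
    have h1 : e.repr v 1 ≠ 0 := fun h1 => hvℓ (mem_span_iff_repr.mpr ⟨h0, h1⟩)
    refine (gen (e 1) ?_ fun hc => by simpa using (mem_span_iff_repr.mp hc).2).symm
    have h2 := H.smul_mem (e.repr v 1)⁻¹ (H.sub_mem hv (h23 (e.repr v 2) (e.repr v 3)))
    convert h2 using 1
    have h3 : v - (e.repr v 2 • e 2 + e.repr v 3 • e 3) = e.repr v 1 • e 1 :=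
      sub_eq_iff_eq_add.mpr (hvd.trans (by rw [h0]; module))
    rw [h3, smul_smul, inv_mul_cancel₀ h1, one_smul]
  · left
    refine ⟨e.repr v 1 / e.repr v 0, ?_⟩
    have hu : e 0 + (e.repr v 1 / e.repr v 0) • e 1 ∈ H := by
      have h2 := H.smul_mem (e.repr v 0)⁻¹ (H.sub_mem hv (h23 (e.repr v 2) (e.repr v 3)))
      convert h2 using 1
      have h3 : v - (e.repr v 2 • e 2 + e.repr v 3 • e 3) =
          e.repr v 0 • e 0 + e.repr v 1 • e 1 := sub_eq_iff_eq_add.mpr (hvd.trans (by module))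
      rw [h3, smul_add, smul_smul, smul_smul, inv_mul_cancel₀ h0,
        one_smul, div_eq_inv_mul]
    rw [← gen _ hu fun hc => by simpa using (mem_span_iff_repr.mp hc).1]
    ext w
    rw [mem_pencilPlane, Submodule.mem_sup]
    constructor
    · rintro ⟨y, hy, z, hz, rfl⟩
      obtain ⟨s, rfl⟩ := Submodule.mem_span_singleton.mp hy
      obtain ⟨hz0, hz1⟩ := mem_span_iff_repr.mp hz
      simp [hz0, hz1, mul_comm]
    · intro hw
      refine ⟨_, Submodule.mem_span_singleton.mpr ⟨e.repr w 0, rfl⟩, _,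
        Submodule.mem_span_pair.mpr ⟨e.repr w 2, e.repr w 3, rfl⟩, ?_⟩
      conv_rhs => rw [e.eq_combination w, hw]
      module

end Coordinates

theorem lemma3p8 (F : MvPolynomial (Fin 4) ℂ) (hF : IsQuarticForm F)
    (hfin : (linesOn F).Finite)
    (ℓ₀ : Submodule ℂ (Fin 4 → ℂ)) (hℓ₀ : IsLineOfDoublePoints F ℓ₀) :
    {H ∈ planesThrough ℓ₀ |
      ¬ ((∃ q, IsResidualConic F ℓ₀ H q) ∧
        ∀ q, IsResidualConic F ℓ₀ H q → (linesMeetingConic F H q).encard ≤ 19)}.Finite := by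
  obtain ⟨e, Q, rfl, h, hd⟩ := exists_generic_coordinates hF.1 hfin hℓ₀
  have hQ := h.nonvanishing hfin
  -- The excluded planes are x = 0, those containing a second line of the surface, and those whose
  -- conic meets another line in a point of ℓ that is not a base point.
  refine ((((finite_parameters_of_lines hfin e).union
    (finite_exceptional_parameters hfin e Q)).image (pencilPlane e)).insert
      (Submodule.span ℂ {e 1} ⊔ Submodule.span ℂ {e 2, e 3})).subset ?_
  rintro H ⟨hH, hbad⟩
  rcases eq_pencilPlane_or_eq hH with ⟨t, rfl⟩ | rfl
  swap
  · exact Set.mem_insert _ _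
  refine Set.mem_insert_of_mem _ ⟨t, ?_, rfl⟩
  by_contra ht
  simp only [Set.mem_union, not_or] at ht
  obtain ⟨ht1, ht2⟩ := ht
  refine hbad ⟨h.exists_residualConic hQ t, fun q hq => ?_⟩
  refine le_trans (Set.encard_le_encard ?_) (h.encard_lines_le hfin hd)
  rintro L ⟨hL, v, hv0, hvL, hvH, hqv⟩
  by_cases hLℓ : L = Submodule.span ℂ {e 2, e 3}
  · exact Or.inl (Or.inl hLℓ)
  by_cases hdisj : L ⊓ Submodule.span ℂ {e 2, e 3} = ⊥
  · exact Or.inl (Or.inr ⟨hL, hdisj⟩)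
  refine Or.inr ⟨hL, hLℓ, ?_⟩
  have hqz := h.eq_zero_of_residualConic hq hvH hqv
  obtain ⟨p, ⟨hpL, hpℓ⟩, hp0⟩ := Submodule.exists_mem_ne_zero_of_ne_bot hdisj
  -- Otherwise L would be spanned by v and the point p of ℓ, hence lie in H, which is excluded.
  have hvℓ : v ∈ Submodule.span ℂ {e 2, e 3} := by
    by_contra hvℓ
    apply ht1
    refine ⟨L, hL, hLℓ, ?_⟩
    have hli : LinearIndependent ℂ ![p, v] := by
      rw [LinearIndependent.pair_iff' hp0]
      rintro s rfl
      exact hvℓ (Submodule.smul_mem _ s hpℓ)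
    rw [← span_pair_eq_of_isProjLine hL.1 hpL hvL hli, Submodule.span_le]
    rintro w (rfl | rfl)
    · exact hH.2 hpℓ
    · exact hvH
  obtain ⟨z, w, rfl⟩ := Submodule.mem_span_pair.mp hvℓ
  simp at hqz
  have hzw : (z, w) ≠ (0 : ℂ × ℂ) := by
    intro h0
    obtain ⟨rfl, rfl⟩ := Prod.mk.inj h0
    simp at hv0
  refine ⟨(z, w), ?_, hvL⟩
  by_contra hb
  exact ht2 ⟨L, hL, hLℓ, (z, w), hzw, hb, hvL, hqz⟩
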